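/- Let $k,d\ge 0$ be integers, let $n=k+d$, and let $\Lambda\in M_{k,d}([0,\infty))$. Put $$\Theta=\begin{pmatrix}0_{k\times k}&\Lambda\\-\Lambda^{T}&0_{d\times d}\end{pmatrix}\in M_n(\mathbb R),\qquad \sigma_\Theta(p,q)=e^{-\pi i\langle p,\Theta q\rangle}\quad(p,q\in\mathbb N^n).$$ For $p\in\mathbb N^n$ let $L_p$ be the isometry on $\ell^2(\mathbb N^n)$ given on the canonical basis by $L_p\delta_q=\sigma_\Theta(p,q)\delta_{p+q}$, and let $\mathcal T_r(\mathbb N^n,\sigma_\Theta)\subseteq\mathcal B(\ell^2(\mathbb N^n))$ be the C*-algebra generated by $\{L_p : p\in\mathbb N^n\}$. Let $I$ be the closed two-sided ideal of $\mathcal T_r(\mathbb N^n,\sigma_\Theta)$ generated by the projections $1-L_{e_j}L_{e_j}^*$, $j=k+1,\dots,k+d$. Let $B_\Lambda$ be the universal unital C*-algebra generated by elements $v_p$ $(p\in\mathbb N^k)$ and unitaries $u_x$ $(x\in\mathbb Z^d)$ such that $v$ is a Nica covariant isometric representation of $\mathbb N^k$ (that is, $v_0=1$, $v_{p+q}=v_pv_q$,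 $v_p^*v_p=1$ and $v_pv_p^*v_qv_q^*=v_{p\vee q}v_{p\vee q}^*$, where $p\vee q$ is the coordinatewise maximum), $u$ is a unitary representation of $\mathbb Z^d$, and $$u_xv_p=e^{2\pi i\langle p,\Lambda x\rangle}v_pu_x\qquad(x\in\mathbb Z^d,\ p\in\mathbb N^k).$$ Then $B_\Lambda$ is canonically isomorphic to $\mathcal T_r(\mathbb N^n,\sigma_\Theta)/I$: there is a unique isometric $*$-isomorphism $\Phi\colon B_\Lambda\to\mathcal T_r(\mathbb N^n,\sigma_\Theta)/I$ (the quotient carrying the quotient norm) such that $\Phi(v_p)=L_{(p,0)}+I$ for all $p\in\mathbb N^k$ and $\Phi(u_x)=L_{(0,x)}+I$ for all $x\in\mathbb N^d$. -/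

import Mathlib

universe w

open scoped ENNReal CStarAlgebra

noncomputable section

/-! ### Twisted semigroup C*-algebras -/

/-- The Hilbert space `ℓ²(P)`. -/
abbrev EllTwo (P : Type*) : Type _ := lp (fun _ : P => ℂ) 2

/-- The canonical unit vector `δ_q` of `ℓ²(P)`. -/
def deltaVec {P : Type*} [DecidableEq P] (q : P) : EllTwo P := lp.single 2 q (1 : ℂ)

theorem orthonormal_twisted {P : Type*} [DecidableEq P] [AddCommMonoid P] [IsCancelAdd P]
    (σ : P → P → Circle) (p : P) :
    Orthonormal ℂ (fun q : P => (σ p q : ℂ) • deltaVec (p + q)) := by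
  constructor
  · intro q
    rw [norm_smul, deltaVec, lp.norm_single (by norm_num), Circle.norm_coe]
    simp
  · intro q r hqr
    have h : p + q ≠ p + r := fun h => hqr (add_left_cancel h)
    simp only [inner_smul_left, inner_smul_right, deltaVec]
    rw [lp.inner_single_left]
    simp [lp.single_apply, h]

/-- The operator `L_p` on `ℓ²(P)` with `L_p δ_q = σ(p,q) δ_{p+q}`, as a linear isometry. -/
def twistedShiftIsometry {P : Type*} [DecidableEq P] [AddCommMonoid P] [IsCancelAdd P]
    (σ : P → P → Circle) (p : P) : EllTwo P →ₗᵢ[ℂ] EllTwo P :=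
  (orthonormal_twisted σ p).orthogonalFamily.linearIsometry

/-- The left regular `σ`-representation `p ↦ L_p` of `P` on `ℓ²(P)`. -/
def leftRegular {P : Type*} [DecidableEq P] [AddCommMonoid P] [IsCancelAdd P]
    (σ : P → P → Circle) (p : P) : EllTwo P →L[ℂ] EllTwo P :=
  (twistedShiftIsometry σ p).toContinuousLinearMap

theorem leftRegular_deltaVec {P : Type*} [DecidableEq P] [AddCommMonoid P] [IsCancelAdd P]
    (σ : P → P → Circle) (p q : P) :
    leftRegular σ p (deltaVec q) = (σ p q : ℂ) • deltaVec (p + q) := by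
  change (orthonormal_twisted σ p).orthogonalFamily.linearIsometry (lp.single 2 q (1 : ℂ)) = _
  rw [OrthogonalFamily.linearIsometry_apply_single]
  simp

/-- The reduced twisted semigroup C*-algebra `𝒯_r(P, σ)`: the C*-subalgebra of `B(ℓ²(P))`
generated by the operators `L_p`, `p ∈ P`. -/
def reducedTwisted {P : Type*} [DecidableEq P] [AddCommMonoid P] [IsCancelAdd P]
    (σ : P → P → Circle) : StarSubalgebra ℂ (EllTwo P →L[ℂ] EllTwo P) :=
  (StarAlgebra.adjoin ℂ (Set.range (leftRegular σ))).topologicalClosure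

instance {P : Type*} [DecidableEq P] [AddCommMonoid P] [IsCancelAdd P] (σ : P → P → Circle) :
    IsClosed (reducedTwisted σ : Set (EllTwo P →L[ℂ] EllTwo P)) :=
  StarSubalgebra.isClosed_topologicalClosure _

/-- The generator `L_p` as an element of `𝒯_r(P, σ)`. -/
def reducedTwisted.gen {P : Type*} [DecidableEq P] [AddCommMonoid P] [IsCancelAdd P]
    (σ : P → P → Circle) (p : P) : reducedTwisted σ :=
  ⟨leftRegular σ p, StarSubalgebra.le_topologicalClosure _
    (StarAlgebra.subset_adjoin ℂ _ (Set.mem_range_self p))⟩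

/-- The symplectic bicharacter `σ_Θ(p,q) = exp(-π i ⟨p, Θ q⟩)` on `ℕⁿ`. -/
def sigmaTheta {n : ℕ} (Θ : Matrix (Fin n) (Fin n) ℝ) (p q : Fin n → ℕ) : Circle :=
  Circle.exp (-Real.pi * ((fun i => (p i : ℝ)) ⬝ᵥ Θ.mulVec (fun i => (q i : ℝ))))

/-! ### Closed ideals and quotients -/

/-- The closed two-sided ideal of `A` generated by the set `S`. -/
def closedIdealSpan {A : Type*} [NormedRing A] (S : Set A) : Ideal A :=
  (TwoSidedIdeal.span S).asIdeal.closure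

instance {A : Type*} [NormedRing A] (S : Set A) : (closedIdealSpan S).IsTwoSided where
  mul_mem_of_left {a} b ha := by
    refine map_mem_closure (f := fun x : A => x * b) (by fun_prop) ha fun x hx => ?_
    exact Ideal.IsTwoSided.mul_mem_of_left b hx

instance {A : Type*} [NormedRing A] (S : Set A) : IsClosed (closedIdealSpan S : Set A) :=
  isClosed_closure

/-- A left ideal that is stable under the involution. -/
class Ideal.IsSelfAdjoint {A : Type*} [Ring A] [StarRing A] (I : Ideal A) : Prop where
  star_mem : ∀ a ∈ I, star a ∈ I

theorem closedIdealSpan_isSelfAdjoint {A : Type*} [NormedRing A] [StarRing A] [ContinuousStar A]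
    {S : Set A} (hS : ∀ s ∈ S, star s ∈ S) : (closedIdealSpan S).IsSelfAdjoint where
  star_mem a ha := by
    refine map_mem_closure (f := fun x : A => star x) (by fun_prop) ha fun x hx => ?_
    have hx' : x ∈ TwoSidedIdeal.span S := TwoSidedIdeal.mem_asIdeal.1 hx
    refine TwoSidedIdeal.mem_asIdeal.2 ?_
    clear hx ha
    induction hx' using TwoSidedIdeal.span_induction with
    | mem x h => exact TwoSidedIdeal.subset_span (hS x h)
    | zero => simp
    | add x y _ _ hx hy =>
      simpa using TwoSidedIdeal.add_mem _ hx hy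
    | neg x _ hx =>
      simpa using TwoSidedIdeal.neg_mem _ hx
    | left_absorb a x _ hx =>
      simpa using TwoSidedIdeal.mul_mem_right _ _ _ hx
    | right_absorb a x _ hx =>
      simpa using TwoSidedIdeal.mul_mem_left _ _ _ hx

/-- The involution `[a] ↦ [a*]` of a quotient `A ⧸ I`; ring and norm on `A ⧸ I` are Mathlib's. -/
instance quotientStarRing {A : Type*} [Ring A] [StarRing A] (I : Ideal A) [I.IsTwoSided]
    [hI : I.IsSelfAdjoint] : StarRing (A ⧸ I) where
  star q := Quotient.liftOn' q (fun a => Ideal.Quotient.mk I (star a)) fun a b hab => by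
    rw [Submodule.quotientRel_def] at hab
    rw [Ideal.Quotient.eq, ← star_sub]
    exact hI.star_mem _ hab
  star_involutive q := by
    obtain ⟨a, rfl⟩ := Ideal.Quotient.mk_surjective q
    exact congrArg (Ideal.Quotient.mk I) (star_star a)
  star_mul q r := by
    obtain ⟨a, rfl⟩ := Ideal.Quotient.mk_surjective q
    obtain ⟨b, rfl⟩ := Ideal.Quotient.mk_surjective r
    exact (congrArg (Ideal.Quotient.mk I) (star_mul a b)).trans (map_mul _ _ _)
  star_add q r := by
    obtain ⟨a, rfl⟩ := Ideal.Quotient.mk_surjective q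
    obtain ⟨b, rfl⟩ := Ideal.Quotient.mk_surjective r
    exact (congrArg (Ideal.Quotient.mk I) (star_add a b)).trans (map_add _ _ _)

/-! ### The universal algebra `B_Λ` -/

/-- A pair `(v, u)` in a unital C*-algebra `A` consisting of a Nica covariant isometric
representation `v` of `ℕᵏ` and a unitary representation `u` of `ℤᵈ` such that
`u_x v_p = exp(2 π i ⟨p, Λ x⟩) v_p u_x`. -/
structure NicaUnitaryPair {k d : ℕ} (Λ : Matrix (Fin k) (Fin d) ℝ) (A : Type*)
    [CStarAlgebra A] where
  v : (Fin k → ℕ) → A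
  u : (Fin d → ℤ) → A
  v_zero : v 0 = 1
  v_add : ∀ p q, v (p + q) = v p * v q
  v_isometry : ∀ p, star (v p) * v p = 1
  v_nica : ∀ p q, v p * star (v p) * (v q * star (v q)) = v (p ⊔ q) * star (v (p ⊔ q))
  u_zero : u 0 = 1
  u_add : ∀ x y, u (x + y) = u x * u y
  u_unitary : ∀ x, u x ∈ unitary A
  u_mul_v : ∀ x p, u x * v p =
    Complex.exp (2 * Real.pi * Complex.I *
      (((fun i => (p i : ℝ)) ⬝ᵥ Λ.mulVec (fun j => (x j : ℝ)) : ℝ) : ℂ)) • (v p * u x)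

/-- All pairs as above in nonzero unital C*-algebras (living in the universe `w`). -/
structure PairIndex {k d : ℕ} (Λ : Matrix (Fin k) (Fin d) ℝ) : Type (w + 1) where
  carrier : Type w
  [cstar : CStarAlgebra carrier]
  [nontriv : Nontrivial carrier]
  pair : NicaUnitaryPair Λ carrier

attribute [instance] PairIndex.cstar PairIndex.nontriv

/-- The `ℓ^∞`-direct product of a family of C*-algebras is a C*-algebra. -/
instance lpInftyCStarAlgebra {ι : Type*} {A : ι → Type*} [∀ i, CStarAlgebra (A i)]
    [∀ i, Nontrivial (A i)] : CStarAlgebra (lp A ∞) where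

/-- The `ℓ^∞`-direct product of the C*-algebras carrying all pairs. -/
abbrev PairProduct {k d : ℕ} (Λ : Matrix (Fin k) (Fin d) ℝ) : Type (w + 1) :=
  lp (fun i : PairIndex.{w} Λ => i.carrier) ∞

theorem norm_le_one_of_star_mul_self {A : Type*} [CStarAlgebra A] [Nontrivial A] {a : A}
    (h : star a * a = 1) : ‖a‖ ≤ 1 := by
  have h1 := CStarRing.norm_star_mul_self (x := a)
  rw [h, CStarRing.norm_one] at h1
  nlinarith [norm_nonneg a]

/-- The direct product of all isometries `v_p`. -/
def productV {k d : ℕ} (Λ : Matrix (Fin k) (Fin d) ℝ) (p : Fin k → ℕ) : PairProduct.{w} Λ :=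
  ⟨fun i => i.pair.v p, memℓp_infty ⟨1, by
    rintro _ ⟨i, rfl⟩
    exact norm_le_one_of_star_mul_self (i.pair.v_isometry p)⟩⟩

/-- The direct product of all unitaries `u_x`. -/
def productU {k d : ℕ} (Λ : Matrix (Fin k) (Fin d) ℝ) (x : Fin d → ℤ) : PairProduct.{w} Λ :=
  ⟨fun i => i.pair.u x, memℓp_infty ⟨1, by
    rintro _ ⟨i, rfl⟩
    exact norm_le_one_of_star_mul_self (Unitary.star_mul_self_of_mem (i.pair.u_unitary x))⟩⟩

/-- The universal C*-algebra `B_Λ`: the C*-subalgebra generated by the `v_p` and the `u_x` in the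
direct product over all pairs. -/
def BLambda {k d : ℕ} (Λ : Matrix (Fin k) (Fin d) ℝ) :
    StarSubalgebra ℂ (PairProduct.{w} Λ) :=
  (StarAlgebra.adjoin ℂ
    (Set.range (productV.{w} Λ) ∪ Set.range (productU.{w} Λ))).topologicalClosure

instance BLambda.instIsClosed {k d : ℕ} (Λ : Matrix (Fin k) (Fin d) ℝ) :
    IsClosed (BLambda.{w} Λ : Set (PairProduct.{w} Λ)) :=
  StarSubalgebra.isClosed_topologicalClosure _

/-- The canonical pair `(v, u)` in `B_Λ`. -/
def BLambda.pair {k d : ℕ} (Λ : Matrix (Fin k) (Fin d) ℝ) :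
    NicaUnitaryPair Λ (BLambda.{w} Λ) where
  v p := ⟨productV Λ p, StarSubalgebra.le_topologicalClosure _
    (StarAlgebra.subset_adjoin ℂ _ (Or.inl (Set.mem_range_self p)))⟩
  u x := ⟨productU Λ x, StarSubalgebra.le_topologicalClosure _
    (StarAlgebra.subset_adjoin ℂ _ (Or.inr (Set.mem_range_self x)))⟩
  v_zero := Subtype.ext <| lp.ext <| funext fun i => i.pair.v_zero
  v_add p q := Subtype.ext <| lp.ext <| funext fun i => i.pair.v_add p q
  v_isometry p := Subtype.ext <| lp.ext <| funext fun i => i.pair.v_isometry p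
  v_nica p q := Subtype.ext <| lp.ext <| funext fun i => i.pair.v_nica p q
  u_zero := Subtype.ext <| lp.ext <| funext fun i => i.pair.u_zero
  u_add x y := Subtype.ext <| lp.ext <| funext fun i => i.pair.u_add x y
  u_unitary x := by
    refine Unitary.mem_iff.2 ⟨?_, ?_⟩
    · exact Subtype.ext <| lp.ext <| funext fun i =>
        Unitary.star_mul_self_of_mem (i.pair.u_unitary x)
    · exact Subtype.ext <| lp.ext <| funext fun i =>
        Unitary.mul_star_self_of_mem (i.pair.u_unitary x)
  u_mul_v x p := Subtype.ext <| lp.ext <| funext fun i => i.pair.u_mul_v x p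

/-- Evaluation of the direct product at one pair. -/
def PairIndex.eval {k d : ℕ} {Λ : Matrix (Fin k) (Fin d) ℝ} (i : PairIndex.{w} Λ) :
    PairProduct.{w} Λ →⋆ₐ[ℂ] i.carrier where
  toFun f := f i
  map_one' := rfl
  map_mul' _ _ := rfl
  map_zero' := rfl
  map_add' _ _ := rfl
  commutes' _ := rfl
  map_star' _ := rfl

/-- The universal property of `B_Λ`. -/
theorem BLambda.existsUnique_lift {k d : ℕ} (Λ : Matrix (Fin k) (Fin d) ℝ) {A : Type w}
    [CStarAlgebra A] [Nontrivial A] (r : NicaUnitaryPair Λ A) :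
    ∃! φ : BLambda.{w} Λ →⋆ₐ[ℂ] A,
      (∀ p, φ ((BLambda.pair Λ).v p) = r.v p) ∧ (∀ x, φ ((BLambda.pair Λ).u x) = r.u x) := by
  let i : PairIndex.{w} Λ := ⟨A, r⟩
  refine ⟨i.eval.comp (BLambda.{w} Λ).subtype, ⟨fun _ => rfl, fun _ => rfl⟩, ?_⟩
  rintro ψ ⟨hv, hu⟩
  have hc : ∀ χ : BLambda.{w} Λ →⋆ₐ[ℂ] A, Continuous χ := fun χ => map_continuous χ
  refine StarAlgHom.ext_topologicalClosure (hc ψ) (hc _) ?_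
  refine StarAlgHom.ext_adjoin ?_
  rintro ⟨_, _⟩ (⟨p, rfl⟩ | ⟨x, rfl⟩)
  · exact hv p
  · exact hu x

/-! ### The block matrix and the quotient -/

/-- The block matrix `Θ` with zero diagonal blocks and off-diagonal blocks `Λ` and `-Λᵀ`. -/
def blockTheta {k d : ℕ} (Λ : Matrix (Fin k) (Fin d) ℝ) :
    Matrix (Fin (k + d)) (Fin (k + d)) ℝ :=
  Matrix.reindex finSumFinEquiv finSumFinEquiv (Matrix.fromBlocks 0 Λ (-Λ.transpose) 0)

/-- The Toeplitz noncommutative torus `𝒯_r(ℕ^{k+d}, σ_Θ)`. -/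
abbrev ToeplitzTorus {k d : ℕ} (Λ : Matrix (Fin k) (Fin d) ℝ) : Type :=
  reducedTwisted (sigmaTheta (blockTheta Λ))

/-- The isometry `L_p`, `p ∈ ℕ^{k+d}`, in `𝒯_r(ℕ^{k+d}, σ_Θ)`. -/
abbrev ToeplitzTorus.gen {k d : ℕ} (Λ : Matrix (Fin k) (Fin d) ℝ) (p : Fin (k + d) → ℕ) :
    ToeplitzTorus Λ :=
  reducedTwisted.gen (sigmaTheta (blockTheta Λ)) p

/-- The projections `1 - L_{e_j} L_{e_j}*` for the last `d` coordinates `j` of `ℕ^{k+d}`. -/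
def defectProjections {k d : ℕ} (Λ : Matrix (Fin k) (Fin d) ℝ) : Set (ToeplitzTorus Λ) :=
  Set.range fun j : Fin d =>
    1 - ToeplitzTorus.gen Λ (Pi.single (Fin.natAdd k j) 1) *
      star (ToeplitzTorus.gen Λ (Pi.single (Fin.natAdd k j) 1))

/-- The (closed two-sided) ideal generated by these projections. -/
abbrev defectIdeal {k d : ℕ} (Λ : Matrix (Fin k) (Fin d) ℝ) : Ideal (ToeplitzTorus Λ) :=
  closedIdealSpan (defectProjections Λ)

instance {k d : ℕ} (Λ : Matrix (Fin k) (Fin d) ℝ) : (defectIdeal Λ).IsSelfAdjoint :=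
  closedIdealSpan_isSelfAdjoint <| by
    rintro _ ⟨j, rfl⟩
    exact ⟨j, by simp⟩

/-- The quotient of `𝒯_r(ℕ^{k+d}, σ_Θ)` by the ideal, with the quotient norm. -/
abbrev ToeplitzQuotient {k d : ℕ} (Λ : Matrix (Fin k) (Fin d) ℝ) : Type :=
  ToeplitzTorus Λ ⧸ defectIdeal Λ

end

/-! ### Algebra of Nica covariant pairs -/

namespace NicaUnitaryPair

variable {k d : ℕ} {Λ : Matrix (Fin k) (Fin d) ℝ} {A : Type*} [CStarAlgebra A]

/-! Write `Q` for the quotient of the Toeplitz torus by the defect ideal. In the Toeplitz torus the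
isometries L_{(p,0)} and L_{(0,x)} satisfy every relation of `NicaUnitaryPair` except that L_{(0,x)}
need not be unitary; its defect 1 - L L* lies in the ideal (`one_sub_W_mem`). Extended from ℕᵈ to
ℤᵈ, the images in `Q` form a pair, and the universal property gives a homomorphism φ from `BLambda
Λ` to `Q`.

For this, `Q` must be a C*-algebra under the quotient norm. Every a in the ideal satisfies ‖a
L_{(0,x)}‖ → 0 as x → ∞ (`vanishesAtInfinity_of_mem`), so the projections L_{(0,x)} L_{(0,x)}* form
an explicit approximate unit of the ideal, which gives the C*-identity. The same limit shows that 1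
is not in the ideal.

Injectivity is a gauge-invariant uniqueness argument. The monomials v_p v_q* u_x span a dense
subspace, and the gauge action multiplies each by a character of its degree (p - q, x). Sums over
finite grids of the torus replace the integral defining the conditional expectation onto the
diagonal, the closed span of the v_p v_p*; faithfulness is `eq_zero_of_gaugeSum_le`. The norm of a
diagonal element ∑ cᵢ v_{pᵢ} v_{pᵢ}* is controlled by its partial sums over pᵢ ≤ q
(`norm_sum_smul_proj_le`). Each such sum is the limit, as y → ∞, of the matrix coefficients at
δ_{(q,y)} of a lift to the Toeplitz torus. Elements of the ideal contribute zero to this limit, so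
the sum is bounded by the norm in `Q` (`norm_sum_diagonal_le`).

An injective *-homomorphism is isometric, so φ has closed range; the range contains the generators,
hence φ is onto. Uniqueness holds because the prescribed values determine a *-homomorphism. -/

theorem star_u (r : NicaUnitaryPair Λ A) (x : Fin d → ℤ) : star (r.u x) = r.u (-x) := by
  have h1 : star (r.u x) * r.u x = 1 := Unitary.star_mul_self_of_mem (r.u_unitary x)
  have h2 : r.u x * r.u (-x) = 1 := by rw [← r.u_add, add_neg_cancel, r.u_zero]
  exact left_inv_eq_right_inv h1 h2

/-- Inserting v*v = 1 at both ends exposes the product of two range projections, to which Nica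
covariance applies. This is the rule that moves adjoints to the right in a product of monomials. -/
theorem star_v_mul_v (r : NicaUnitaryPair Λ A) (p q : Fin k → ℕ) :
    star (r.v p) * r.v q = r.v (p ⊔ q - p) * star (r.v (p ⊔ q - q)) := by
  have hp : p + (p ⊔ q - p) = p ⊔ q := add_tsub_cancel_of_le le_sup_left
  have hq : q + (p ⊔ q - q) = p ⊔ q := add_tsub_cancel_of_le le_sup_right
  have hp' : star (r.v p) * r.v (p ⊔ q) = r.v (p ⊔ q - p) := by
    conv_lhs => rw [← hp, r.v_add, ← mul_assoc, r.v_isometry, one_mul]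
  have hq' : star (r.v (p ⊔ q)) * r.v q = star (r.v (p ⊔ q - q)) := by
    conv_lhs => rw [← hq, r.v_add, star_mul, mul_assoc, r.v_isometry, mul_one]
  calc star (r.v p) * r.v q
      = (star (r.v p) * r.v p) * star (r.v p) * (r.v q * (star (r.v q) * r.v q)) := by
        rw [r.v_isometry, r.v_isometry, one_mul, mul_one]
    _ = star (r.v p) * (r.v p * star (r.v p) * (r.v q * star (r.v q))) * r.v q := by
        simp only [mul_assoc]
    _ = (star (r.v p) * r.v (p ⊔ q)) * (star (r.v (p ⊔ q)) * r.v q) := by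
        rw [r.v_nica]; simp only [mul_assoc]
    _ = _ := by rw [hp', hq']

theorem exists_u_mul_v (r : NicaUnitaryPair Λ A) (x : Fin d → ℤ) (p : Fin k → ℕ) :
    ∃ c : ℂ, c ≠ 0 ∧ r.u x * r.v p = c • (r.v p * r.u x) :=
  ⟨_, Complex.exp_ne_zero _, r.u_mul_v x p⟩

/-- Adjoint of the commutation relation for u_{-x}, divided by its nonzero scalar. -/
theorem exists_u_mul_star_v (r : NicaUnitaryPair Λ A) (x : Fin d → ℤ) (p : Fin k → ℕ) :
    ∃ c : ℂ, r.u x * star (r.v p) = c • (star (r.v p) * r.u x) := by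
  obtain ⟨c, hc, h⟩ := r.exists_u_mul_v (-x) p
  have h' := congrArg star h
  rw [star_smul, star_mul, star_mul, star_u, neg_neg] at h'
  have hc' : star c ≠ 0 := star_ne_zero.2 hc
  exact ⟨(star c)⁻¹, by rw [h', smul_smul, inv_mul_cancel₀ hc', one_smul]⟩

/-- The monomial `v_p v_q* u_x`. -/
def mono (r : NicaUnitaryPair Λ A) (m : (Fin k → ℕ) × (Fin k → ℕ) × (Fin d → ℤ)) : A :=
  r.v m.1 * star (r.v m.2.1) * r.u m.2.2

theorem exists_mono_mul (r : NicaUnitaryPair Λ A)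
    (m n : (Fin k → ℕ) × (Fin k → ℕ) × (Fin d → ℤ)) :
    ∃ c : ℂ, ∃ l, r.mono m * r.mono n = c • r.mono l := by
  obtain ⟨p, q, x⟩ := m
  obtain ⟨p', q', x'⟩ := n
  obtain ⟨c, -, hc⟩ := r.exists_u_mul_v x p'
  obtain ⟨c', hc'⟩ := r.exists_u_mul_star_v x q'
  refine ⟨c * c', (p + (q ⊔ p' - q), q' + (q ⊔ p' - p'), x + x'), ?_⟩
  simp only [mono]
  calc r.v p * star (r.v q) * r.u x * (r.v p' * star (r.v q') * r.u x')
      = r.v p * star (r.v q) * (r.u x * r.v p') * star (r.v q') * r.u x' := by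
        simp only [mul_assoc]
    _ = c • (r.v p * (star (r.v q) * r.v p') * (r.u x * star (r.v q')) * r.u x') := by
        rw [hc]; simp only [mul_assoc, smul_mul_assoc, mul_smul_comm]
    _ = (c * c') • (r.v p * r.v (q ⊔ p' - q) * (star (r.v (q ⊔ p' - p')) * star (r.v q')) *
          (r.u x * r.u x')) := by
        rw [hc', star_v_mul_v]
        simp only [mul_assoc, smul_mul_assoc, mul_smul_comm, smul_smul]
    _ = _ := by rw [← r.v_add, ← star_mul, ← r.v_add, ← r.u_add]

theorem exists_star_mono (r : NicaUnitaryPair Λ A)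
    (m : (Fin k → ℕ) × (Fin k → ℕ) × (Fin d → ℤ)) :
    ∃ c : ℂ, ∃ l, star (r.mono m) = c • r.mono l := by
  obtain ⟨p, q, x⟩ := m
  obtain ⟨c, -, hc⟩ := r.exists_u_mul_v (-x) q
  obtain ⟨c', hc'⟩ := r.exists_u_mul_star_v (-x) p
  refine ⟨c * c', (q, p, -x), ?_⟩
  simp only [mono, star_mul, star_star, star_u]
  rw [← mul_assoc, hc, smul_mul_assoc, mul_assoc, hc', mul_smul_comm, smul_smul, mul_assoc]

theorem mono_zero (r : NicaUnitaryPair Λ A) : r.mono (0, 0, 0) = 1 := by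
  simp [mono, r.v_zero, r.u_zero]

theorem mono_v (r : NicaUnitaryPair Λ A) (p : Fin k → ℕ) : r.mono (p, 0, 0) = r.v p := by
  simp [mono, r.v_zero, r.u_zero]

theorem mono_u (r : NicaUnitaryPair Λ A) (x : Fin d → ℤ) : r.mono (0, 0, x) = r.u x := by
  simp [mono, r.v_zero]

/-- Up to scalars, monomials are closed under products and adjoints, so their linear span is already
a *-algebra. -/
theorem adjoin_subset_span_mono (r : NicaUnitaryPair Λ A) {a : A}
    (ha : a ∈ StarAlgebra.adjoin ℂ (Set.range r.v ∪ Set.range r.u)) :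
    a ∈ Submodule.span ℂ (Set.range r.mono) := by
  have hmono : ∀ m, r.mono m ∈ Submodule.span ℂ (Set.range r.mono) := fun m =>
    Submodule.subset_span (Set.mem_range_self m)
  induction ha using StarAlgebra.adjoin_induction with
  | mem x h =>
    rcases h with ⟨p, rfl⟩ | ⟨x, rfl⟩
    · rw [← mono_v]; exact hmono _
    · rw [← mono_u]; exact hmono _
  | algebraMap c =>
    rw [Algebra.algebraMap_eq_smul_one, ← r.mono_zero]
    exact Submodule.smul_mem _ _ (hmono _)
  | add x y _ _ hx hy => exact add_mem hx hy
  | mul x y hx' hy' hx hy =>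
    clear hx' hy'
    induction hx, hy using Submodule.span_induction₂ with
    | mem_mem x y hx hy =>
      obtain ⟨m, rfl⟩ := hx
      obtain ⟨n, rfl⟩ := hy
      obtain ⟨c, l, h⟩ := r.exists_mono_mul m n
      rw [h]
      exact Submodule.smul_mem _ _ (hmono _)
    | zero_left => simp
    | zero_right => simp
    | add_left x y z _ _ _ h1 h2 => rw [add_mul]; exact add_mem h1 h2
    | add_right x y z _ _ _ h1 h2 => rw [mul_add]; exact add_mem h1 h2
    | smul_left c x y _ _ h => rw [smul_mul_assoc]; exact Submodule.smul_mem _ _ h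
    | smul_right c x y _ _ h => rw [mul_smul_comm]; exact Submodule.smul_mem _ _ h
  | star x hx' hx =>
    clear hx'
    induction hx using Submodule.span_induction with
    | mem x hx =>
      obtain ⟨m, rfl⟩ := hx
      obtain ⟨c, l, h⟩ := r.exists_star_mono m
      rw [h]
      exact Submodule.smul_mem _ _ (hmono _)
    | zero => simp
    | add x y _ _ h1 h2 => rw [star_add]; exact add_mem h1 h2
    | smul c x _ h => rw [star_smul]; exact Submodule.smul_mem _ _ h

/-- The range projection `v_p v_p*`. -/
def proj (r : NicaUnitaryPair Λ A) (p : Fin k → ℕ) : A := r.v p * star (r.v p)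

theorem proj_mul (r : NicaUnitaryPair Λ A) (p q : Fin k → ℕ) :
    r.proj p * r.proj q = r.proj (p ⊔ q) := r.v_nica p q

theorem star_proj (r : NicaUnitaryPair Λ A) (p : Fin k → ℕ) : star (r.proj p) = r.proj p := by
  simp [proj]

theorem proj_zero (r : NicaUnitaryPair Λ A) : r.proj 0 = 1 := by
  simp [proj, r.v_zero]

open Classical in
/-- Estimate for linear combinations of the range projections, via characters of the commutative
C*-algebra generated by these projections. -/
theorem norm_sum_smul_proj_le (r : NicaUnitaryPair Λ A) {ι : Type*} (s : Finset ι) (c : ι → ℂ)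
    (p : ι → Fin k → ℕ) {M : ℝ} (hM : ∀ q, ‖∑ i ∈ s with p i ≤ q, c i‖ ≤ M) :
    ‖∑ i ∈ s, c i • r.proj (p i)‖ ≤ M := by
  have hM0 : 0 ≤ M := (norm_nonneg _).trans (hM 0)
  let S : StarSubalgebra ℂ A := (StarAlgebra.adjoin ℂ (Set.range r.proj)).topologicalClosure
  have hcl : IsClosed (S : Set A) := StarSubalgebra.isClosed_topologicalClosure _
  have hcomm : ∀ x ∈ StarAlgebra.adjoin ℂ (Set.range r.proj),
      ∀ y ∈ StarAlgebra.adjoin ℂ (Set.range r.proj), x * y = y * x := by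
    have := StarAlgebra.isMulCommutative_adjoin ℂ (s := Set.range r.proj)
      (by rintro _ ⟨p, rfl⟩ _ ⟨q, rfl⟩; rw [proj_mul, proj_mul, sup_comm])
      (by rintro _ ⟨p, rfl⟩ _ ⟨q, rfl⟩; rw [star_proj, proj_mul, proj_mul, sup_comm])
    intro x hx y hy
    exact congrArg Subtype.val
      (mul_comm' (⟨x, hx⟩ : StarAlgebra.adjoin ℂ (Set.range r.proj)) ⟨y, hy⟩)
  let hS : CStarAlgebra S := StarSubalgebra.cstarAlgebra S
  let : CommCStarAlgebra S :=
    { hS with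
      mul_comm := (StarSubalgebra.commRingTopologicalClosure _
        (fun x y => Subtype.ext (hcomm x x.2 y y.2))).mul_comm }
  let e : (Fin k → ℕ) → S := fun q => ⟨r.proj q, StarSubalgebra.le_topologicalClosure _
    (StarAlgebra.subset_adjoin ℂ _ (Set.mem_range_self q))⟩
  have he : ∀ p q, e p * e q = e (p ⊔ q) := fun p q => Subtype.ext (r.proj_mul p q)
  have he0 : e 0 = 1 := Subtype.ext r.proj_zero
  have hsum : ((∑ i ∈ s, c i • e (p i) : S) : A) = ∑ i ∈ s, c i • r.proj (p i) := by
    simp [e]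
  rw [← hsum]
  change ‖(∑ i ∈ s, c i • e (p i) : S)‖ ≤ M
  rw [← (AddMonoidHomClass.isometry_iff_norm _).1 (gelfandTransform_isometry S)]
  refine (ContinuousMap.norm_le _ hM0).2 fun χ => ?_
  have hχ : ∀ q, χ (e q) = 0 ∨ χ (e q) = 1 := fun q => by
    have h : χ (e q) * χ (e q) = χ (e q) := by rw [← map_mul, he, sup_idem]
    rcases eq_or_ne (χ (e q)) 0 with h0 | h0
    · exact Or.inl h0
    · exact Or.inr (mul_left_cancel₀ h0 (h.trans (mul_one _).symm))
  -- A character takes only the values 0 and 1 on the projections. Since e_p e_q = e_{p ∨ q}, the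
  -- supremum of the finitely many indices with value 1 again has value 1 (the empty supremum is 0,
  -- and e_0 = 1). Thus χ acts on the given sum as the indicator of p i ≤ q.
  let q : Fin k → ℕ := {i ∈ s | χ (e (p i)) = 1}.sup p
  have hq : χ (e q) = 1 := by
    refine Finset.sup_induction (p := fun q => χ (e q) = 1) ?_ ?_ ?_
    · exact (congrArg χ he0).trans (map_one χ)
    · intro a ha b hb
      rw [← he, map_mul, ha, hb, one_mul]
    · intro i hi
      exact (Finset.mem_filter.1 hi).2
  have hle : ∀ i ∈ s, (χ (e (p i)) = 1 ↔ p i ≤ q) := by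
    refine fun i hi => ⟨fun h => Finset.le_sup (Finset.mem_filter.2 ⟨hi, h⟩), fun h => ?_⟩
    have h1 : χ (e (p i)) * χ (e q) = χ (e q) := by rw [← map_mul, he, sup_of_le_right h]
    rwa [hq, mul_one] at h1
  have hval : WeakDual.gelfandTransform ℂ S (∑ i ∈ s, c i • e (p i)) χ =
      ∑ i ∈ s with p i ≤ q, c i := by
    rw [WeakDual.gelfandTransform_apply_apply, map_sum, Finset.sum_filter]
    refine Finset.sum_congr rfl fun i hi => ?_
    rw [map_smul, smul_eq_mul]
    split_ifs with h
    · rw [(hle i hi).2 h, mul_one]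
    · rw [(hχ (p i)).resolve_right (mt (hle i hi).1 h), mul_zero]
  rw [hval]
  exact hM q

end NicaUnitaryPair

/-! ### The gauge action on `B_Λ` -/

/-- The character `m ↦ exp(2 π i ⟨t, m⟩)` of `ℤ^ι`. -/
noncomputable def phase {ι : Type*} [Fintype ι] (t : ι → ℝ) (m : ι → ℤ) : Circle :=
  Circle.exp (2 * Real.pi * ∑ l, t l * m l)

/-! ### Characters of ℤ^ι and their orthogonality on finite grids -/

section phase

variable {ι : Type*} [Fintype ι]

theorem phase_zero_right (t : ι → ℝ) : phase t 0 = 1 := by simp [phase]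

theorem phase_zero_left (m : ι → ℤ) : phase 0 m = 1 := by simp [phase]

theorem phase_add (t : ι → ℝ) (m n : ι → ℤ) : phase t (m + n) = phase t m * phase t n := by
  simp [phase, ← Circle.exp_add, mul_add, Finset.sum_add_distrib]

theorem phase_neg (t : ι → ℝ) (m : ι → ℤ) : phase t (-m) = (phase t m)⁻¹ := by
  simp [phase, ← Circle.exp_neg]

theorem continuous_phase (m : ι → ℤ) : Continuous fun t : ι → ℝ => phase t m := by
  unfold phase
  fun_prop

theorem phase_eq_prod (t : ι → ℝ) (m : ι → ℤ) :
    (phase t m : ℂ) = ∏ l, Complex.exp (2 * Real.pi * Complex.I * (t l * m l)) := by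
  rw [phase, Circle.coe_exp, ← Complex.exp_sum]
  congr 1
  push_cast
  rw [Finset.mul_sum, Finset.sum_mul]
  exact Finset.sum_congr rfl fun l _ => by ring

/-- A geometric sum of powers of ζ = exp(2πi m/N): ζ^N = 1, and 0 < |m| < N excludes ζ = 1. -/
theorem sum_range_exp_eq_zero {N : ℕ} {m : ℤ} (hm : m ≠ 0) (hmN : |m| < N) :
    ∑ j ∈ Finset.range N, Complex.exp (2 * Real.pi * Complex.I * (((j / N : ℝ) : ℂ) * m)) = 0 := by
  have hN : (N : ℂ) ≠ 0 := by
    rintro h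
    rw [Nat.cast_eq_zero] at h
    subst h
    exact absurd hmN (not_lt.2 (by simp))
  set ζ : ℂ := Complex.exp (2 * Real.pi * Complex.I * (m / N)) with hζ
  have hpow : ∀ j : ℕ,
      Complex.exp (2 * Real.pi * Complex.I * (((j / N : ℝ) : ℂ) * m)) = ζ ^ j := fun j => by
    rw [hζ, ← Complex.exp_nat_mul]
    congr 1
    push_cast
    ring
  have hζN : ζ ^ N = 1 := by
    rw [hζ, ← Complex.exp_nat_mul, Complex.exp_eq_one_iff]
    exact ⟨m, by field_simp⟩
  have hζ1 : ζ ≠ 1 := by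
    rw [hζ, Ne, Complex.exp_eq_one_iff]
    rintro ⟨n, hn⟩
    have h2 : (m : ℂ) / N = n :=
      mul_left_cancel₀ Complex.two_pi_I_ne_zero (by linear_combination hn)
    rw [div_eq_iff hN] at h2
    have h3 : m = n * N := by exact_mod_cast h2
    have hn0 : n ≠ 0 := by rintro rfl; exact hm (by simpa using h3)
    have h4 : (1 : ℤ) ≤ |n| := Int.one_le_abs hn0
    rw [h3, abs_mul, Nat.abs_cast] at hmN
    nlinarith [Nat.cast_nonneg (α := ℤ) N]
  simp_rw [hpow]
  rw [geom_sum_eq hζ1, hζN, sub_self, zero_div]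

/-- The grid points of `[0, 1)^ι` with denominator `N`, indexed by their numerators. -/
noncomputable def grid (ι : Type*) [Fintype ι] (N : ℕ) : Finset (ι → ℕ) :=
  letI := Classical.decEq ι
  Fintype.piFinset fun _ : ι => Finset.range N

theorem mem_grid {N : ℕ} {i : ι → ℕ} : i ∈ grid ι N ↔ ∀ l, i l < N := by
  simp [grid]

theorem card_grid (N : ℕ) : (grid ι N).card = N ^ Fintype.card ι := by
  simp [grid]

/-- The sum factors over the coordinates, and a coordinate with m l ≠ 0 contributes a vanishing
factor. -/
theorem sum_grid_phase {N : ℕ} {m : ι → ℤ} (hm : ∀ l, |m l| < N) :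
    ∑ i ∈ grid ι N, (phase (fun l => (i l / N : ℝ)) m : ℂ) =
      if m = 0 then (N : ℂ) ^ Fintype.card ι else 0 := by
  split_ifs with h
  · subst h
    simp [phase_zero_right, card_grid]
  · classical
    obtain ⟨l, hl⟩ := Function.ne_iff.1 h
    simp_rw [phase_eq_prod]
    rw [grid]
    have := Finset.prod_univ_sum (fun _ : ι => Finset.range N) (fun (l : ι) (j : ℕ) =>
      Complex.exp (2 * Real.pi * Complex.I * (((j / N : ℝ) : ℂ) * m l)))
    convert this.symm.trans (Finset.prod_eq_zero (Finset.mem_univ l)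
      (sum_range_exp_eq_zero hl (hm l)))

end phase

/-! ### Gauge action, its continuity, and faithfulness of finite averages -/

section gauge

variable {k d : ℕ} {Λ : Matrix (Fin k) (Fin d) ℝ}

/-- The pair `(v, u)` multiplied by the character of `ℤ^{k+d}` given by `t`. -/
noncomputable def NicaUnitaryPair.twist {A : Type*} [CStarAlgebra A] (r : NicaUnitaryPair Λ A)
    (t : Fin k ⊕ Fin d → ℝ) : NicaUnitaryPair Λ A where
  v p := (phase t (Sum.elim (fun i => (p i : ℤ)) 0) : ℂ) • r.v p
  u x := (phase t (Sum.elim (0 : Fin k → ℤ) x) : ℂ) • r.u x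
  v_zero := by
    have : (Sum.elim (fun i => (((0 : Fin k → ℕ) i : ℕ) : ℤ)) 0 : Fin k ⊕ Fin d → ℤ) = 0 := by
      ext (i | j) <;> simp
    rw [this, phase_zero_right, r.v_zero, Circle.coe_one, one_smul]
  v_add p q := by
    have : (Sum.elim (fun i => (((p + q) i : ℕ) : ℤ)) 0 : Fin k ⊕ Fin d → ℤ) =
        Sum.elim (fun i => (p i : ℤ)) 0 + Sum.elim (fun i => (q i : ℤ)) 0 := by
      ext (i | j) <;> simp
    rw [this, phase_add, r.v_add, smul_mul_smul_comm, Circle.coe_mul]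
  v_isometry p := by
    rw [star_smul, smul_mul_smul_comm, r.v_isometry, Complex.star_def, ← Circle.coe_inv_eq_conj,
      ← Circle.coe_mul, inv_mul_cancel, Circle.coe_one, one_smul]
  v_nica p q := by
    have h : ∀ (z : Circle) (a : A), ((z : ℂ) • a) * star ((z : ℂ) • a) = a * star a := by
      intro z a
      rw [star_smul, smul_mul_smul_comm, Complex.star_def, ← Circle.coe_inv_eq_conj,
        ← Circle.coe_mul, mul_inv_cancel, Circle.coe_one, one_smul]
    rw [h, h, h, r.v_nica]
  u_zero := by
    have : (Sum.elim 0 0 : Fin k ⊕ Fin d → ℤ) = 0 := by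
      ext (i | j) <;> simp
    rw [this, phase_zero_right, r.u_zero, Circle.coe_one, one_smul]
  u_add x y := by
    have : (Sum.elim (0 : Fin k → ℤ) (x + y) : Fin k ⊕ Fin d → ℤ) =
        Sum.elim (0 : Fin k → ℤ) x + Sum.elim (0 : Fin k → ℤ) y := by
      ext (i | j) <;> simp
    rw [this, phase_add, r.u_add, smul_mul_smul_comm, Circle.coe_mul]
  u_unitary x := by
    rw [Unitary.mem_iff, star_smul, smul_mul_smul_comm, smul_mul_smul_comm,
      Unitary.star_mul_self_of_mem (r.u_unitary x), Unitary.mul_star_self_of_mem (r.u_unitary x),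
      Complex.star_def, ← Circle.coe_inv_eq_conj, ← Circle.coe_mul, ← Circle.coe_mul,
      mul_inv_cancel, inv_mul_cancel, Circle.coe_one, one_smul]
    exact ⟨rfl, rfl⟩
  u_mul_v x p := by
    rw [smul_mul_smul_comm, r.u_mul_v, smul_mul_smul_comm, smul_comm,
      mul_comm (phase t _ : ℂ)]

/-- The degree `(p - q, x)` of the monomial `v_p v_q* u_x`. -/
def monoDegree (m : (Fin k → ℕ) × (Fin k → ℕ) × (Fin d → ℤ)) : Fin k ⊕ Fin d → ℤ :=
  Sum.elim (fun i => (m.1 i : ℤ) - m.2.1 i) m.2.2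

theorem monoDegree_eq_zero_iff {m : (Fin k → ℕ) × (Fin k → ℕ) × (Fin d → ℤ)} :
    monoDegree m = 0 ↔ m.1 = m.2.1 ∧ m.2.2 = 0 := by
  simp only [funext_iff, Sum.forall, monoDegree, Sum.elim_inl, Sum.elim_inr, Pi.zero_apply,
    sub_eq_zero, Nat.cast_inj]

theorem NicaUnitaryPair.twist_mono {A : Type*} [CStarAlgebra A] (r : NicaUnitaryPair Λ A)
    (t : Fin k ⊕ Fin d → ℝ) (m : (Fin k → ℕ) × (Fin k → ℕ) × (Fin d → ℤ)) :
    (r.twist t).mono m = (phase t (monoDegree m) : ℂ) • r.mono m := by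
  obtain ⟨p, q, x⟩ := m
  have h : (monoDegree (p, q, x) : Fin k ⊕ Fin d → ℤ) =
      Sum.elim (fun i => (p i : ℤ)) 0 + -Sum.elim (fun i => (q i : ℤ)) 0 +
        Sum.elim (0 : Fin k → ℤ) x := by
    ext (i | j) <;> simp [monoDegree, sub_eq_add_neg]
  rw [h, phase_add, phase_add, phase_neg]
  simp only [mono, twist, star_smul, smul_mul_smul_comm, Circle.coe_mul, Circle.coe_inv_eq_conj,
    Complex.star_def]

/-- The index of the twisted pair. -/
noncomputable def PairIndex.twist (i : PairIndex.{w} Λ) (t : Fin k ⊕ Fin d → ℝ) :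
    PairIndex.{w} Λ where
  carrier := i.carrier
  cstar := i.cstar
  nontriv := i.nontriv
  pair := i.pair.twist t

/-- The gauge automorphism of the direct product of all pairs. -/
noncomputable def gaugeHom (Λ : Matrix (Fin k) (Fin d) ℝ) (t : Fin k ⊕ Fin d → ℝ) :
    PairProduct.{w} Λ →⋆ₐ[ℂ] PairProduct.{w} Λ where
  -- The family of all pairs is stable under twisting, so the action is a mere reindexing of
  -- coordinates.
  toFun f := ⟨fun i => f (i.twist t), by
    obtain ⟨C, hC⟩ := memℓp_infty_iff.1 (lp.memℓp f)
    refine memℓp_infty ⟨C, ?_⟩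
    rintro _ ⟨i, rfl⟩
    exact hC ⟨i.twist t, rfl⟩⟩
  map_one' := rfl
  map_mul' _ _ := rfl
  map_zero' := rfl
  map_add' _ _ := rfl
  commutes' _ := rfl
  map_star' _ := rfl

theorem norm_gaugeHom_le (t : Fin k ⊕ Fin d → ℝ) (f : PairProduct.{w} Λ) :
    ‖gaugeHom Λ t f‖ ≤ ‖f‖ := NonUnitalStarAlgHom.norm_apply_le (gaugeHom Λ t) f

theorem gaugeHom_mono (t : Fin k ⊕ Fin d → ℝ) (m : (Fin k → ℕ) × (Fin k → ℕ) × (Fin d → ℤ)) :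
    gaugeHom Λ t ((BLambda.pair.{w} Λ).mono m : BLambda.{w} Λ) =
      (phase t (monoDegree m) : ℂ) • (((BLambda.pair.{w} Λ).mono m : BLambda.{w} Λ) :
        PairProduct.{w} Λ) :=
  lp.ext <| funext fun i => i.pair.twist_mono t m

theorem BLambda.mem_closure_span_mono (b : BLambda.{w} Λ) :
    b ∈ closure (Submodule.span ℂ (Set.range (BLambda.pair.{w} Λ).mono) : Set (BLambda.{w} Λ)) := by
  obtain ⟨b, hb⟩ := b
  have hsub : ∀ a ∈ StarAlgebra.adjoin ℂ (Set.range (productV.{w} Λ) ∪ Set.range (productU.{w} Λ)),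
      ∃ a' ∈ Submodule.span ℂ (Set.range (BLambda.pair.{w} Λ).mono),
        (a' : PairProduct.{w} Λ) = a := by
    intro a ha
    have h : (StarAlgebra.adjoin ℂ (Set.range (BLambda.pair.{w} Λ).v ∪
        Set.range (BLambda.pair.{w} Λ).u)).map (BLambda.{w} Λ).subtype =
        StarAlgebra.adjoin ℂ (Set.range (productV.{w} Λ) ∪ Set.range (productU.{w} Λ)) := by
      rw [StarAlgHom.map_adjoin, Set.image_union, ← Set.range_comp, ← Set.range_comp]
      rfl
    rw [← h] at ha
    obtain ⟨a', ha', rfl⟩ := ha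
    exact ⟨a', (BLambda.pair.{w} Λ).adjoin_subset_span_mono ha', rfl⟩
  rw [closure_subtype]
  refine closure_mono ?_ hb
  intro a ha
  obtain ⟨a', h, rfl⟩ := hsub a ha
  exact ⟨a', h, rfl⟩

theorem continuous_gaugeHom (b : BLambda.{w} Λ) :
    Continuous fun t => gaugeHom Λ t (b : PairProduct.{w} Λ) := by
  have hcl : b ∈ closure {b : BLambda.{w} Λ |
      Continuous fun t => gaugeHom Λ t (b : PairProduct.{w} Λ)} := by
    refine closure_mono (fun a ha => ?_) (BLambda.mem_closure_span_mono b)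
    change Continuous _
    induction ha using Submodule.span_induction with
    | mem x hx =>
      obtain ⟨m, rfl⟩ := hx
      simp_rw [gaugeHom_mono]
      exact (continuous_subtype_val.comp (continuous_phase _)).smul continuous_const
    | zero => simpa using continuous_const
    | add x y _ _ h1 h2 =>
      simp only [AddMemClass.coe_add, map_add]
      exact h1.add h2
    | smul c x _ h =>
      simp only [SetLike.val_smul, map_smul]
      exact h.const_smul c
  -- Each `gaugeHom Λ t` is contractive, so approximation in norm is uniform in t and preserves
  -- continuity.
  rw [Metric.mem_closure_iff] at hcl
  refine continuous_of_uniform_approx_of_continuous fun u hu => ?_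
  obtain ⟨ε, hε, hεu⟩ := Metric.mem_uniformity_dist.1 hu
  obtain ⟨a, ha, hab⟩ := hcl ε hε
  refine ⟨_, ha, fun t => hεu ?_⟩
  rw [dist_eq_norm, ← map_sub]
  refine (norm_gaugeHom_le t _).trans_lt ?_
  rwa [dist_eq_norm] at hab

theorem gaugeHom_zero (b : BLambda.{w} Λ) :
    gaugeHom Λ 0 (b : PairProduct.{w} Λ) = b := by
  have hcl : IsClosed {b : BLambda.{w} Λ | gaugeHom Λ 0 (b : PairProduct.{w} Λ) = b} :=
    isClosed_eq ((AddMonoidHomClass.continuous_of_bound (gaugeHom Λ 0) 1 fun f => by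
      simpa using norm_gaugeHom_le 0 f).comp continuous_subtype_val)
      continuous_subtype_val
  refine hcl.closure_subset_iff.2 (fun a ha => ?_) (BLambda.mem_closure_span_mono b)
  change gaugeHom Λ 0 (a : PairProduct.{w} Λ) = a
  induction ha using Submodule.span_induction with
  | mem x hx =>
    obtain ⟨m, rfl⟩ := hx
    rw [gaugeHom_mono, phase_zero_left, Circle.coe_one, one_smul]
  | zero => simp
  | add x y _ _ h1 h2 => simp only [AddMemClass.coe_add, map_add, h1, h2]
  | smul c x _ h => simp only [SetLike.val_smul, map_smul, h]

/-- The sum of the translates of `b` under the gauge action over the grid of denominator `N`. -/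
noncomputable def gaugeSum (N : ℕ) (b : PairProduct.{w} Λ) : PairProduct.{w} Λ :=
  ∑ i ∈ grid (Fin k ⊕ Fin d) N, gaugeHom Λ (fun l => (i l / N : ℝ)) b

theorem norm_gaugeSum_le (N : ℕ) (b : PairProduct.{w} Λ) :
    ‖gaugeSum N b‖ ≤ N ^ (k + d) * ‖b‖ := by
  refine (norm_sum_le_of_le _ fun i _ => norm_gaugeHom_le _ b).trans_eq ?_
  simp [card_grid]

theorem gaugeSum_sub (N : ℕ) (a b : PairProduct.{w} Λ) :
    gaugeSum N (a - b) = gaugeSum N a - gaugeSum N b := by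
  simp [gaugeSum]

theorem gaugeSum_mono {N : ℕ} {m : (Fin k → ℕ) × (Fin k → ℕ) × (Fin d → ℤ)}
    (hm : ∀ l, |monoDegree m l| < N) :
    gaugeSum N ((BLambda.pair.{w} Λ).mono m : BLambda.{w} Λ) =
      if monoDegree m = 0 then (N : ℂ) ^ (k + d) •
        ((BLambda.pair.{w} Λ).proj m.1 : PairProduct.{w} Λ) else 0 := by
  simp_rw [gaugeSum, gaugeHom_mono]
  rw [← Finset.sum_smul, sum_grid_phase hm]
  split_ifs with h
  · obtain ⟨p, q, x⟩ := m
    obtain ⟨h1, h2⟩ := monoDegree_eq_zero_iff.1 h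
    obtain rfl : p = q := h1
    obtain rfl : x = 0 := h2
    simp [NicaUnitaryPair.mono, NicaUnitaryPair.proj, NicaUnitaryPair.u_zero]
  · simp

attribute [local instance] CStarAlgebra.spectralOrder CStarAlgebra.spectralOrderedRing

/-- The gauge averages of a positive element of `B_Λ` cannot become arbitrarily small. -/
theorem eq_zero_of_gaugeSum_le (b : BLambda.{w} Λ)
    (h : ∀ δ > 0, ∃ N₀ : ℕ, ∀ N ≥ N₀,
      ‖gaugeSum N ((star b * b : BLambda.{w} Λ) : PairProduct.{w} Λ)‖ ≤ N ^ (k + d) * δ) :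
    b = 0 := by
  set a : PairProduct.{w} Λ := ((star b * b : BLambda.{w} Λ) : PairProduct.{w} Λ) with ha
  have hpos : ∀ t, 0 ≤ gaugeHom Λ t a := fun t => by
    have : gaugeHom Λ t a = star (gaugeHom Λ t b) * gaugeHom Λ t b := by
      rw [ha, ← map_star, ← map_mul]; rfl
    rw [this]
    exact star_mul_self_nonneg _
  have key : ∀ ε > 0, ‖a‖ ≤ ε := by
    intro ε hε
    have hcont := (continuous_gaugeHom (star b * b)).tendsto 0
    have hgauge0 : gaugeHom Λ 0 a = a := gaugeHom_zero _
    obtain ⟨η, hη, hηε⟩ := Metric.tendsto_nhds_nhds.1 hcont (ε / 2) (half_pos hε)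
    obtain ⟨M, hM⟩ := exists_nat_gt (1 / η)
    have hM0 : (0 : ℝ) < M := (one_div_pos.2 hη).trans hM
    -- With N = M * L, the grid points whose numerators are below L lie in the cube [0, 1/M)^(k+d),
    -- within η of 0, and make up the fraction M^{-(k+d)} of the grid. The bound δ compensates this
    -- factor. Taking L = N₀ + 1 makes L positive and N ≥ N₀.
    obtain ⟨N₀, hN₀⟩ := h (ε / 2 / M ^ (k + d)) (by positivity)
    set L : ℕ := N₀ + 1
    have hL0 : (0 : ℝ) < L := by positivity
    have hM1 : 1 ≤ M := by exact_mod_cast hM0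
    have h1 := hN₀ (M * L) (N₀.le_succ.trans (Nat.le_mul_of_pos_left _ hM1))
    set N : ℕ := M * L
    have hNeq : (N : ℝ) = M * L := by simp [N]
    have hsub : grid (Fin k ⊕ Fin d) L ⊆ grid (Fin k ⊕ Fin d) N := fun i hi => by
      rw [mem_grid] at hi ⊢
      exact fun l => (hi l).trans_le (Nat.le_mul_of_pos_left _ hM1)
    set s := ∑ i ∈ grid (Fin k ⊕ Fin d) L, gaugeHom Λ (fun l => (i l / N : ℝ)) a with hs
    -- All translates of a are positive, so discarding those outside the small cube can only lower
    -- the norm; each remaining translate is within ε/2 of a.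
    have h2 : ‖s‖ ≤ ‖gaugeSum N a‖ :=
      CStarAlgebra.norm_le_norm_of_nonneg_of_le (Finset.sum_nonneg fun i _ => hpos _)
        (Finset.sum_le_sum_of_subset_of_nonneg hsub fun i _ _ => hpos _)
    have h3 : ‖s - (L : ℝ) ^ (k + d) • a‖ ≤ (L : ℝ) ^ (k + d) * (ε / 2) := by
      have : s - (L : ℝ) ^ (k + d) • a =
          ∑ i ∈ grid (Fin k ⊕ Fin d) L, (gaugeHom Λ (fun l => (i l / N : ℝ)) a - a) := by
        rw [Finset.sum_sub_distrib, Finset.sum_const, card_grid, ← Nat.cast_smul_eq_nsmul ℝ]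
        simp [hs]
      rw [this]
      refine (norm_sum_le_of_le (n := fun _ => ε / 2) _ fun i hi => ?_).trans_eq
        (by simp [card_grid])
      have := @hηε (fun l => (i l / N : ℝ)) (by
        rw [dist_zero_right, pi_norm_lt_iff hη]
        intro l
        have hil : (i l : ℝ) < L := by exact_mod_cast mem_grid.1 hi l
        rw [Real.norm_of_nonneg (by positivity), hNeq, div_lt_iff₀ (by positivity)]
        have : 1 < η * M := by rwa [div_lt_iff₀' hη] at hM
        nlinarith)
      rw [hgauge0, dist_eq_norm] at this
      exact this.le
    have h4 : (L : ℝ) ^ (k + d) * ‖a‖ ≤ (L : ℝ) ^ (k + d) * ε := by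
      calc (L : ℝ) ^ (k + d) * ‖a‖ = ‖(L : ℝ) ^ (k + d) • a‖ := by
            rw [norm_smul, Real.norm_of_nonneg (by positivity)]
        _ ≤ ‖s‖ + ‖s - (L : ℝ) ^ (k + d) • a‖ := by
            rw [norm_sub_rev]; exact norm_le_norm_add_norm_sub' _ _
        _ ≤ (N : ℝ) ^ (k + d) * (ε / 2 / M ^ (k + d)) + (L : ℝ) ^ (k + d) * (ε / 2) :=
            add_le_add (h2.trans h1) h3
        _ = (L : ℝ) ^ (k + d) * ε := by
            rw [hNeq, mul_pow]; field_simp; ring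
    exact le_of_mul_le_mul_left h4 (by positivity)
  have ha0 : ‖a‖ = 0 := le_antisymm (le_of_forall_pos_le_add fun ε hε => by
    simpa using key ε hε) (norm_nonneg _)
  have hb : star b * b = 0 := Subtype.ext (norm_eq_zero.1 ha0)
  exact (CStarRing.star_mul_self_eq_zero_iff b).1 hb

end gauge

/-! ### Injectivity tested on the diagonal -/

section injectivity

variable {k d : ℕ} {Λ : Matrix (Fin k) (Fin d) ℝ}

theorem BLambda.norm_coe (b : BLambda.{w} Λ) : ‖(b : PairProduct.{w} Λ)‖ = ‖b‖ := rfl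

/-- On a fixed finite sum, a fine enough grid gives exactly N^(k+d) times the conditional
expectation onto the diagonal. -/
theorem gaugeSum_sum_smul_mono {N : ℕ} (s : Finset ((Fin k → ℕ) × (Fin k → ℕ) × (Fin d → ℤ)))
    (c : (Fin k → ℕ) × (Fin k → ℕ) × (Fin d → ℤ) → ℂ)
    (hN : ∀ m ∈ s, ∀ l, |monoDegree m l| < N) :
    gaugeSum N ((∑ m ∈ s, c m • (BLambda.pair.{w} Λ).mono m : BLambda.{w} Λ) :
        PairProduct.{w} Λ) =
      (N : ℂ) ^ (k + d) • ((∑ m ∈ s with monoDegree m = 0,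
        c m • (BLambda.pair.{w} Λ).proj m.1 : BLambda.{w} Λ) : PairProduct.{w} Λ) := by
  have h : gaugeSum N ((∑ m ∈ s, c m • (BLambda.pair.{w} Λ).mono m : BLambda.{w} Λ) :
        PairProduct.{w} Λ) =
      ∑ m ∈ s, c m • gaugeSum N ((BLambda.pair.{w} Λ).mono m : PairProduct.{w} Λ) := by
    simp only [gaugeSum, AddSubmonoidClass.coe_finsetSum, SetLike.val_smul, map_sum, map_smul,
      Finset.smul_sum]
    exact Finset.sum_comm
  rw [h, Finset.sum_filter, AddSubmonoidClass.coe_finsetSum, Finset.smul_sum]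
  refine Finset.sum_congr rfl fun m hm => ?_
  rw [gaugeSum_mono (hN m hm)]
  split_ifs
  · rw [SetLike.val_smul, smul_comm]
  · simp

open Classical in
/-- A `*`-homomorphism on `B_Λ` is injective if it dominates the values of the characters of the
diagonal on the conditional expectation of `B_Λ` onto the diagonal. -/
theorem BLambda.injective_of_norm_diagonal_le {Q : Type*} [CStarAlgebra Q]
    (φ : BLambda.{w} Λ →⋆ₐ[ℂ] Q)
    (H : ∀ (c : (Fin k → ℕ) × (Fin k → ℕ) × (Fin d → ℤ) →₀ ℂ) (q : Fin k → ℕ),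
      ‖∑ m ∈ c.support with monoDegree m = 0 ∧ m.1 ≤ q, c m‖ ≤
        ‖φ (∑ m ∈ c.support, c m • (BLambda.pair.{w} Λ).mono m)‖) :
    Function.Injective φ := by
  refine (injective_iff_map_eq_zero φ).2 fun b hb => eq_zero_of_gaugeSum_le b fun δ hδ => ?_
  have hφ : φ (star b * b) = 0 := by rw [map_mul, hb, mul_zero]
  obtain ⟨a, ha, hab⟩ := Metric.mem_closure_iff.1
    (BLambda.mem_closure_span_mono (star b * b)) (δ / 2) (half_pos hδ)
  obtain ⟨c, rfl⟩ := Finsupp.mem_span_range_iff_exists_finsupp.1 ha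
  set a := c.sum fun m z => z • (BLambda.pair.{w} Λ).mono m with ha'
  rw [dist_eq_norm] at hab
  -- This threshold exceeds every coordinate of every degree in a, so the grid sum of a sees only
  -- its diagonal part. That part is small because φ a approximates φ (b* b) = 0; the remaining δ/2
  -- comes from a ≈ b* b.
  refine ⟨∑ m ∈ c.support, ∑ l, (monoDegree m l).natAbs + 1, fun N hN => ?_⟩
  have hdeg : ∀ m ∈ c.support, ∀ l, |monoDegree m l| < N := by
    intro m hm l
    have h1 : (monoDegree m l).natAbs ≤ ∑ l, (monoDegree m l).natAbs :=
      Finset.single_le_sum (f := fun l => (monoDegree m l).natAbs) (fun _ _ => Nat.zero_le _)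
        (Finset.mem_univ l)
    have h2 : ∑ l, (monoDegree m l).natAbs ≤ ∑ m ∈ c.support, ∑ l, (monoDegree m l).natAbs :=
      Finset.single_le_sum (f := fun m => ∑ l, (monoDegree m l).natAbs)
        (fun _ _ => Nat.zero_le _) hm
    rw [Int.abs_eq_natAbs]
    omega
  have hφa : ‖φ a‖ ≤ δ / 2 := by
    rw [← norm_neg, ← zero_sub, ← hφ, ← map_sub]
    exact (NonUnitalStarAlgHom.norm_apply_le φ _).trans hab.le
  have hdiag : ‖gaugeSum N (a : PairProduct.{w} Λ)‖ ≤ N ^ (k + d) * (δ / 2) := by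
    rw [ha', Finsupp.sum, gaugeSum_sum_smul_mono _ _ hdeg, norm_smul, norm_pow,
      Complex.norm_natCast]
    refine mul_le_mul_of_nonneg_left ?_ (by positivity)
    have hproj : ‖∑ m ∈ c.support with monoDegree m = 0,
        c m • (BLambda.pair.{w} Λ).proj m.1‖ ≤ δ / 2 := by
      refine (BLambda.pair.{w} Λ).norm_sum_smul_proj_le _ c (fun m => m.1) fun q => ?_
      rw [Finset.filter_filter]
      convert (H c q).trans hφa
    rw [BLambda.norm_coe]
    convert hproj
  calc ‖gaugeSum N ((star b * b : BLambda.{w} Λ) : PairProduct.{w} Λ)‖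
      ≤ ‖gaugeSum N (a : PairProduct.{w} Λ)‖ +
        ‖gaugeSum N ((star b * b : BLambda.{w} Λ) : PairProduct.{w} Λ) -
          gaugeSum N (a : PairProduct.{w} Λ)‖ := norm_le_norm_add_norm_sub' _ _
    _ ≤ N ^ (k + d) * (δ / 2) + N ^ (k + d) * (δ / 2) := by
        refine add_le_add hdiag ?_
        rw [← gaugeSum_sub]
        refine (norm_gaugeSum_le N _).trans (mul_le_mul_of_nonneg_left hab.le (by positivity))
    _ = N ^ (k + d) * δ := by ring

end injectivity

/-! ### Quotients of C*-algebras -/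

theorem Ideal.Quotient.star_mk {A : Type*} [Ring A] [StarRing A] (I : Ideal A) [I.IsTwoSided]
    [I.IsSelfAdjoint] (a : A) :
    star (Ideal.Quotient.mk I a) = Ideal.Quotient.mk I (star a) := rfl

section quotient

variable {A : Type*} [CStarAlgebra A] (I : Ideal A) [I.IsTwoSided] [hI : IsClosed (I : Set A)]

theorem Ideal.Quotient.exists_mk_eq_norm_lt (x : A ⧸ I) {ε : ℝ} (hε : 0 < ε) :
    ∃ a : A, Ideal.Quotient.mk I a = x ∧ ‖a‖ < ‖x‖ + ε :=
  Submodule.Quotient.norm_mk_lt x hε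

theorem Ideal.Quotient.norm_mk_le_norm (a : A) : ‖Ideal.Quotient.mk I a‖ ≤ ‖a‖ :=
  Submodule.Quotient.norm_mk_le I a

/-- The quotient of a C*-algebra by a closed two-sided ideal is a normed ring. -/
@[reducible]
noncomputable def Ideal.Quotient.normedRingOfIsTwoSided : NormedRing (A ⧸ I) where
  __ := Submodule.Quotient.normedAddCommGroup I
  __ := Ideal.Quotient.ring I
  norm_mul_le x y := by
    have key : ∀ ε > (0 : ℝ), ‖x * y‖ ≤ (‖x‖ + ε) * (‖y‖ + ε) := by
      intro ε hε
      obtain ⟨a, rfl, ha⟩ := Ideal.Quotient.exists_mk_eq_norm_lt I x hε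
      obtain ⟨b, rfl, hb⟩ := Ideal.Quotient.exists_mk_eq_norm_lt I y hε
      rw [← map_mul]
      calc _ ≤ ‖a * b‖ := Ideal.Quotient.norm_mk_le_norm I _
        _ ≤ ‖a‖ * ‖b‖ := norm_mul_le a b
        _ ≤ _ := mul_le_mul ha.le hb.le (norm_nonneg b) ((norm_nonneg a).trans ha.le)
    have hlim : Filter.Tendsto (fun ε : ℝ => (‖x‖ + ε) * (‖y‖ + ε)) (nhdsWithin 0 (Set.Ioi 0))
        (nhds ((‖x‖ + 0) * (‖y‖ + 0))) :=
      (Continuous.tendsto (by fun_prop) 0).mono_left nhdsWithin_le_nhds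
    simpa using ge_of_tendsto hlim (eventually_nhdsWithin_of_forall key)

/-- The C*-identity for the quotient norm, given a right approximate unit of `I`. -/
theorem Ideal.Quotient.norm_mul_self_le_of_approximateUnit [I.IsSelfAdjoint]
    (happrox : ∀ i ∈ I, ∀ ε > (0 : ℝ), ∃ e : A, ‖e‖ ≤ 1 ∧ 1 - e ∈ I ∧ ‖i * e‖ ≤ ε) (x : A ⧸ I) :
    ‖x‖ * ‖x‖ ≤ ‖star x * x‖ := by
  refine le_of_forall_pos_le_add fun ε hε => ?_
  obtain ⟨a, rfl⟩ := Ideal.Quotient.mk_surjective x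
  obtain ⟨m, hm, hmlt⟩ := Ideal.Quotient.exists_mk_eq_norm_lt I
    (star (Ideal.Quotient.mk I a) * Ideal.Quotient.mk I a) (half_pos hε)
  rw [Ideal.Quotient.star_mk, ← map_mul] at hm hmlt
  rw [Ideal.Quotient.star_mk, ← map_mul]
  obtain ⟨e, he, hI, hie⟩ := happrox _ (Ideal.Quotient.eq.1 hm) (ε / 2) (half_pos hε)
  have hae : Ideal.Quotient.mk I (a * e) = Ideal.Quotient.mk I a := by
    refine (Ideal.Quotient.eq.2 ?_).symm
    simpa [mul_sub] using I.mul_mem_left a hI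
  have h1 : ‖Ideal.Quotient.mk I a‖ ≤ ‖a * e‖ := hae ▸ Ideal.Quotient.norm_mk_le_norm I _
  have hstar : ‖star e‖ ≤ 1 := by rwa [norm_star]
  have h2 : ∀ b : A, ‖star e * b‖ ≤ ‖b‖ := fun b =>
    (norm_mul_le _ _).trans (mul_le_of_le_one_left (norm_nonneg b) hstar)
  -- The C*-identity is used in `A` for a * e. There a* a is replaced by m, whose norm is nearly the
  -- quotient norm; since m - a* a lies in I, the error is small after multiplication by e.
  calc ‖Ideal.Quotient.mk I a‖ * ‖Ideal.Quotient.mk I a‖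
      ≤ ‖a * e‖ * ‖a * e‖ := mul_self_le_mul_self (norm_nonneg _) h1
    _ = ‖star (a * e) * (a * e)‖ := CStarRing.norm_star_mul_self.symm
    _ = ‖star e * (m * e) - star e * ((m - star a * a) * e)‖ := by
        congr 1
        simp only [star_mul, sub_mul, mul_sub, mul_assoc, sub_sub_cancel]
    _ ≤ ‖m‖ + ‖(m - star a * a) * e‖ := by
        refine (norm_sub_le _ _).trans (add_le_add ((h2 _).trans ?_) (h2 _))
        exact (norm_mul_le _ _).trans (mul_le_of_le_one_right (norm_nonneg m) he)
    _ ≤ _ := by linarith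

/-- A quotient of a C*-algebra by a closed ideal with a right approximate unit is a C*-algebra. -/
@[reducible]
noncomputable def Ideal.Quotient.cstarAlgebraOfApproximateUnit [I.IsSelfAdjoint]
    (happrox : ∀ i ∈ I, ∀ ε > (0 : ℝ), ∃ e : A, ‖e‖ ≤ 1 ∧ 1 - e ∈ I ∧ ‖i * e‖ ≤ ε) :
    CStarAlgebra (A ⧸ I) where
  __ := Ideal.Quotient.normedRingOfIsTwoSided I
  __ := quotientStarRing I
  __ := Submodule.Quotient.completeSpace I
  __ := Submodule.Quotient.normedSpace I ℂ
  __ := Ideal.Quotient.algebra ℂ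
  norm_mul_self_le := Ideal.Quotient.norm_mul_self_le_of_approximateUnit I happrox
  star_smul c x := by
    obtain ⟨a, rfl⟩ := Ideal.Quotient.mk_surjective x
    exact congrArg (Ideal.Quotient.mk I) (star_smul c a)

end quotient

/-- The lift of a C*-algebra to a larger universe. -/
@[reducible]
noncomputable def ULift.cstarAlgebraOf (A : Type*) [CStarAlgebra A] :
    CStarAlgebra (ULift.{w} A) where
  star a := ⟨star a.down⟩
  star_involutive a := ULift.ext _ _ (star_star a.down)
  star_mul a b := ULift.ext _ _ (star_mul a.down b.down)
  star_add a b := ULift.ext _ _ (star_add a.down b.down)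
  norm_mul_self_le a := CStarRing.norm_mul_self_le a.down
  star_smul c a := ULift.ext _ _ (star_smul c a.down)

/-! ### The left regular representation -/

section leftRegular

variable {P : Type*} [DecidableEq P]

theorem EllTwo.clm_ext {E : Type*} [NormedAddCommGroup E] [NormedSpace ℂ E]
    {S T : EllTwo P →L[ℂ] E} (h : ∀ q, S (deltaVec q) = T (deltaVec q)) : S = T := by
  ext f
  have hf := lp.hasSum_single (p := 2) (by norm_num) f
  have hS := S.hasSum hf
  have hT := T.hasSum hf
  refine hS.unique ?_
  convert hT using 2 with q
  have : lp.single 2 q (f q) = (f q) • (deltaVec q : EllTwo P) := by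
    rw [deltaVec, ← lp.single_smul, smul_eq_mul, mul_one]
  rw [this, map_smul, map_smul, h]

theorem inner_deltaVec (p q : P) :
    inner ℂ (deltaVec p) (deltaVec q : EllTwo P) = if p = q then 1 else 0 := by
  rw [deltaVec, lp.inner_single_left, deltaVec, lp.single_apply]
  split_ifs with h
  · subst h; simp
  · simp [h]

theorem norm_deltaVec (p : P) : ‖(deltaVec p : EllTwo P)‖ = 1 := by
  rw [deltaVec, lp.norm_single (by norm_num), norm_one]

theorem EllTwo.ext_inner_deltaVec {f g : EllTwo P}
    (h : ∀ q, inner ℂ (deltaVec q) f = inner ℂ (deltaVec q) g) : f = g := by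
  refine lp.ext (funext fun q => ?_)
  have := h q
  simp only [deltaVec, lp.inner_single_left] at this
  simpa using this

variable [AddCommMonoid P] [IsCancelAdd P] (σ : P → P → Circle)

theorem star_leftRegular_mul_self (p : P) : star (leftRegular σ p) * leftRegular σ p = 1 :=
  (leftRegular σ p).norm_map_iff_adjoint_comp_self.1 (twistedShiftIsometry σ p).norm_map

theorem star_leftRegular_deltaVec_add (p q : P) :
    star (leftRegular σ p) (deltaVec (p + q)) = star (σ p q : ℂ) • deltaVec q := by
  have h : (deltaVec (p + q) : EllTwo P) = star (σ p q : ℂ) • leftRegular σ p (deltaVec q) := by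
    rw [leftRegular_deltaVec, smul_smul, Complex.star_def, ← Circle.coe_inv_eq_conj,
      ← Circle.coe_mul, inv_mul_cancel, Circle.coe_one, one_smul]
  rw [h, map_smul]
  exact congrArg _ (DFunLike.congr_fun (star_leftRegular_mul_self σ p) (deltaVec q))

theorem star_leftRegular_deltaVec_of_forall_ne {p r : P} (h : ∀ q, p + q ≠ r) :
    star (leftRegular σ p) (deltaVec r) = 0 := by
  refine EllTwo.ext_inner_deltaVec fun q => ?_
  rw [ContinuousLinearMap.star_eq_adjoint, ContinuousLinearMap.adjoint_inner_right,
    leftRegular_deltaVec, inner_smul_left, inner_deltaVec, if_neg (h q), mul_zero, inner_zero_right]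

end leftRegular

/-! ### Twisted shifts on ℓ²(ℕⁿ) and their range projections -/

section twisted

variable {n : ℕ} (Θ : Matrix (Fin n) (Fin n) ℝ)

theorem sigmaTheta_add_left (p p' q : Fin n → ℕ) :
    sigmaTheta Θ (p + p') q = sigmaTheta Θ p q * sigmaTheta Θ p' q := by
  have : (fun i => (((p + p') i : ℕ) : ℝ)) = (fun i => (p i : ℝ)) + fun i => (p' i : ℝ) := by
    ext i; simp
  rw [sigmaTheta, sigmaTheta, sigmaTheta, this, add_dotProduct, mul_add, Circle.exp_add]

theorem sigmaTheta_add_right (p q q' : Fin n → ℕ) :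
    sigmaTheta Θ p (q + q') = sigmaTheta Θ p q * sigmaTheta Θ p q' := by
  have : (fun i => (((q + q') i : ℕ) : ℝ)) = (fun i => (q i : ℝ)) + fun i => (q' i : ℝ) := by
    ext i; simp
  rw [sigmaTheta, sigmaTheta, sigmaTheta, this, Matrix.mulVec_add, dotProduct_add, mul_add,
    Circle.exp_add]

theorem leftRegular_zero : leftRegular (sigmaTheta Θ) 0 = 1 := by
  refine EllTwo.clm_ext fun q => ?_
  rw [leftRegular_deltaVec, zero_add]
  have : sigmaTheta Θ 0 q = 1 := by simp [sigmaTheta]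
  rw [this, Circle.coe_one, one_smul, one_apply_eq_self]

theorem leftRegular_mul (p q : Fin n → ℕ) :
    leftRegular (sigmaTheta Θ) p * leftRegular (sigmaTheta Θ) q =
      (sigmaTheta Θ p q : ℂ) • leftRegular (sigmaTheta Θ) (p + q) := by
  refine EllTwo.clm_ext fun r => ?_
  rw [mul_apply_eq_comp, smul_apply, leftRegular_deltaVec,
    leftRegular_deltaVec, map_smul, leftRegular_deltaVec, smul_smul, smul_smul,
    sigmaTheta_add_right, sigmaTheta_add_left, add_assoc, Circle.coe_mul, Circle.coe_mul]
  congr 1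
  ring

theorem star_leftRegular_deltaVec_of_le {p r : Fin n → ℕ} (h : p ≤ r) :
    star (leftRegular (sigmaTheta Θ) p) (deltaVec r) =
      star (sigmaTheta Θ p (r - p) : ℂ) • deltaVec (r - p) := by
  have := star_leftRegular_deltaVec_add (sigmaTheta Θ) p (r - p)
  rwa [add_tsub_cancel_of_le h] at this

theorem star_leftRegular_deltaVec_of_not_le {p r : Fin n → ℕ} (h : ¬p ≤ r) :
    star (leftRegular (sigmaTheta Θ) p) (deltaVec r) = 0 :=
  star_leftRegular_deltaVec_of_forall_ne _ fun _ hq => h (hq ▸ le_self_add)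

theorem leftRegular_mul_star_deltaVec (p r : Fin n → ℕ) [Decidable (p ≤ r)] :
    (leftRegular (sigmaTheta Θ) p * star (leftRegular (sigmaTheta Θ) p)) (deltaVec r) =
      if p ≤ r then deltaVec r else 0 := by
  rw [mul_apply_eq_comp]
  split_ifs with h
  · rw [star_leftRegular_deltaVec_of_le Θ h, map_smul, leftRegular_deltaVec, smul_smul,
      Complex.star_def, ← Circle.coe_inv_eq_conj, ← Circle.coe_mul, inv_mul_cancel,
      Circle.coe_one, one_smul, add_tsub_cancel_of_le h]
  · rw [star_leftRegular_deltaVec_of_not_le Θ h, map_zero]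

/-- L_p L_p* projects onto the span of the δ_r with r ≥ p, and r ≥ p together with r ≥ q means r ≥ p
⊔ q. -/
theorem leftRegular_nica (p q : Fin n → ℕ) :
    leftRegular (sigmaTheta Θ) p * star (leftRegular (sigmaTheta Θ) p) *
      (leftRegular (sigmaTheta Θ) q * star (leftRegular (sigmaTheta Θ) q)) =
    leftRegular (sigmaTheta Θ) (p ⊔ q) * star (leftRegular (sigmaTheta Θ) (p ⊔ q)) := by
  classical
  refine EllTwo.clm_ext fun r => ?_
  rw [mul_apply_eq_comp, leftRegular_mul_star_deltaVec, leftRegular_mul_star_deltaVec]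
  by_cases hq : q ≤ r
  · rw [if_pos hq, leftRegular_mul_star_deltaVec]
    simp [hq]
  · rw [if_neg hq, map_zero, if_neg fun h => hq (le_sup_right.trans h)]

/-- Induction over the generators of `𝒯_r(P, σ)`, for closed predicates. -/
theorem reducedTwisted.induction {P : Type*} [DecidableEq P] [AddCommMonoid P] [IsCancelAdd P]
    {σ : P → P → Circle} {C : reducedTwisted σ → Prop} (hclosed : IsClosed {a | C a})
    (gen : ∀ p, C (reducedTwisted.gen σ p)) (star_gen : ∀ p, C (star (reducedTwisted.gen σ p)))
    (algebraMap : ∀ c : ℂ, C (algebraMap ℂ _ c)) (add : ∀ a b, C a → C b → C (a + b))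
    (mul : ∀ a b, C a → C b → C (a * b)) (a : reducedTwisted σ) : C a := by
  have hsub : {a : reducedTwisted σ | (a : EllTwo P →L[ℂ] EllTwo P) ∈
      StarAlgebra.adjoin ℂ (Set.range (leftRegular σ))} ⊆ {a | C a} := by
    rintro ⟨a, ha'⟩ (ha : a ∈ Algebra.adjoin ℂ _)
    change C _
    have : ∃ h : a ∈ reducedTwisted σ, C ⟨a, h⟩ := by
      clear ha'
      induction ha using Algebra.adjoin_induction with
      | mem x hx =>
        rcases hx with ⟨p, rfl⟩ | ⟨p, hp⟩
        · exact ⟨_, gen p⟩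
        · obtain rfl : star (leftRegular σ p) = x := by rw [hp, star_star]
          exact ⟨_, star_gen p⟩
      | algebraMap c => exact ⟨_, algebraMap c⟩
      | add x y _ _ hx hy => exact ⟨_, add _ _ hx.2 hy.2⟩
      | mul x y _ _ hx hy => exact ⟨_, mul _ _ hx.2 hy.2⟩
    exact this.2
  refine hclosed.closure_subset_iff.2 hsub ?_
  rw [closure_subtype]
  refine closure_mono ?_ a.2
  intro b hb
  exact ⟨⟨b, StarSubalgebra.le_topologicalClosure _ hb⟩, hb, rfl⟩

end twisted

/-! ### The Toeplitz noncommutative torus -/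

namespace ToeplitzTorus

variable {k d : ℕ} (Λ : Matrix (Fin k) (Fin d) ℝ)

/-- The isometry `L_{(p,0)}`. -/
noncomputable def V (p : Fin k → ℕ) : ToeplitzTorus Λ := gen Λ (Fin.append p 0)

/-- The isometry `L_{(0,x)}`. -/
noncomputable def W (x : Fin d → ℕ) : ToeplitzTorus Λ := gen Λ (Fin.append 0 x)

theorem append_add_append (p p' : Fin k → ℕ) (x x' : Fin d → ℕ) :
    Fin.append p x + Fin.append p' x' = Fin.append (p + p') (x + x') := by
  ext i
  refine Fin.addCases (fun i => ?_) (fun i => ?_) i <;> simp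

theorem append_sub_append (p p' : Fin k → ℕ) (x x' : Fin d → ℕ) :
    Fin.append p x - Fin.append p' x' = Fin.append (p - p') (x - x') := by
  ext i
  refine Fin.addCases (fun i => ?_) (fun i => ?_) i <;> simp

theorem append_sup_append (p p' : Fin k → ℕ) (x x' : Fin d → ℕ) :
    Fin.append p x ⊔ Fin.append p' x' = Fin.append (p ⊔ p') (x ⊔ x') := by
  ext i
  refine Fin.addCases (fun i => ?_) (fun i => ?_) i <;> simp

theorem append_le_append {p p' : Fin k → ℕ} {x x' : Fin d → ℕ} :
    Fin.append p x ≤ Fin.append p' x' ↔ p ≤ p' ∧ x ≤ x' := by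
  simp [Pi.le_def, Fin.forall_fin_add]

theorem append_inj {p p' : Fin k → ℕ} {x x' : Fin d → ℕ} :
    Fin.append p x = Fin.append p' x' ↔ p = p' ∧ x = x' := by
  simp [funext_iff, Fin.forall_fin_add]

theorem sigmaTheta_append (p p' : Fin k → ℕ) (x x' : Fin d → ℕ) :
    sigmaTheta (blockTheta Λ) (Fin.append p x) (Fin.append p' x') =
      Circle.exp (-Real.pi * ((fun i => (p i : ℝ)) ⬝ᵥ Λ.mulVec (fun j => (x' j : ℝ)) -
        (fun i => (p' i : ℝ)) ⬝ᵥ Λ.mulVec (fun j => (x j : ℝ)))) := by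
  rw [sigmaTheta]
  congr 2
  simp only [dotProduct, Matrix.mulVec, Fin.sum_univ_add, Fin.append_left, Fin.append_right,
    blockTheta, Matrix.reindex_apply, Matrix.submatrix_apply, finSumFinEquiv_symm_apply_castAdd,
    finSumFinEquiv_symm_apply_natAdd, Matrix.fromBlocks_apply₁₁, Matrix.fromBlocks_apply₁₂,
    Matrix.fromBlocks_apply₂₁, Matrix.fromBlocks_apply₂₂, Matrix.zero_apply, Matrix.neg_apply,
    Matrix.transpose_apply, zero_mul, Finset.sum_const_zero, zero_add, add_zero, neg_mul,
    Finset.sum_neg_distrib, mul_neg, ← sub_eq_add_neg, Finset.mul_sum]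
  congr 1
  rw [Finset.sum_comm]
  exact Finset.sum_congr rfl fun i _ => Finset.sum_congr rfl fun j _ => by ring

theorem gen_mul (p q : Fin (k + d) → ℕ) :
    gen Λ p * gen Λ q = (sigmaTheta (blockTheta Λ) p q : ℂ) • gen Λ (p + q) :=
  Subtype.ext (leftRegular_mul _ p q)

theorem star_gen_mul_self (p : Fin (k + d) → ℕ) : star (gen Λ p) * gen Λ p = 1 :=
  Subtype.ext (star_leftRegular_mul_self _ p)

theorem gen_nica (p q : Fin (k + d) → ℕ) :
    gen Λ p * star (gen Λ p) * (gen Λ q * star (gen Λ q)) =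
      gen Λ (p ⊔ q) * star (gen Λ (p ⊔ q)) :=
  Subtype.ext (leftRegular_nica _ p q)

theorem gen_zero : gen Λ 0 = 1 := Subtype.ext (leftRegular_zero _)

theorem append_zero_zero : (Fin.append 0 0 : Fin (k + d) → ℕ) = 0 := by
  ext i
  refine Fin.addCases (fun i => ?_) (fun i => ?_) i <;> simp

theorem V_zero : V Λ 0 = 1 := by rw [V, append_zero_zero, gen_zero]

theorem W_zero : W Λ 0 = 1 := by rw [W, append_zero_zero, gen_zero]

theorem V_add (p q : Fin k → ℕ) : V Λ (p + q) = V Λ p * V Λ q := by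
  rw [V, V, V, gen_mul, sigmaTheta_append, append_add_append]
  simp [show (fun _ : Fin d => (0 : ℝ)) = 0 from rfl]

theorem W_add (x y : Fin d → ℕ) : W Λ (x + y) = W Λ x * W Λ y := by
  rw [W, W, W, gen_mul, sigmaTheta_append, append_add_append]
  simp

theorem V_isometry (p : Fin k → ℕ) : star (V Λ p) * V Λ p = 1 := star_gen_mul_self Λ _

theorem W_isometry (x : Fin d → ℕ) : star (W Λ x) * W Λ x = 1 := star_gen_mul_self Λ _

theorem V_nica (p q : Fin k → ℕ) :
    V Λ p * star (V Λ p) * (V Λ q * star (V Λ q)) = V Λ (p ⊔ q) * star (V Λ (p ⊔ q)) := by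
  rw [V, V, V, gen_nica, append_sup_append, sup_idem]

theorem V_mul_W (p : Fin k → ℕ) (x : Fin d → ℕ) :
    V Λ p * W Λ x = (Circle.exp (-Real.pi * ((fun i => (p i : ℝ)) ⬝ᵥ
      Λ.mulVec (fun j => (x j : ℝ)))) : ℂ) • gen Λ (Fin.append p x) := by
  rw [V, W, gen_mul, sigmaTheta_append, append_add_append]
  simp

/-- Both products are multiples of L_{(p,x)}, with conjugate phases exp(±πi⟨p, Λx⟩); their ratio
turns π into 2π. -/
theorem W_mul_V (x : Fin d → ℕ) (p : Fin k → ℕ) :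
    W Λ x * V Λ p = Complex.exp (2 * Real.pi * Complex.I *
      (((fun i => (p i : ℝ)) ⬝ᵥ Λ.mulVec (fun j => (x j : ℝ)) : ℝ) : ℂ)) • (V Λ p * W Λ x) := by
  rw [V_mul_W, V, W, gen_mul, sigmaTheta_append, append_add_append, smul_smul, Circle.coe_exp,
    Circle.coe_exp, ← Complex.exp_add, add_zero, zero_add]
  congr 2
  push_cast
  simp
  ring

theorem exists_V_mul_W (p : Fin k → ℕ) (x : Fin d → ℕ) :
    ∃ c : Circle, V Λ p * W Λ x = (c : ℂ) • (W Λ x * V Λ p) := by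
  refine ⟨(Circle.exp (2 * Real.pi * ((fun i => (p i : ℝ)) ⬝ᵥ
    Λ.mulVec (fun j => (x j : ℝ)))))⁻¹, ?_⟩
  rw [W_mul_V, smul_smul, Circle.coe_inv, Circle.coe_exp, ← Complex.exp_neg, ← Complex.exp_add]
  rw [show ∀ z : ℂ, z = 0 → Complex.exp z = 1 from fun z hz => by rw [hz, Complex.exp_zero],
    one_smul]
  push_cast
  ring

/-- Double commutation, which comes from Nica covariance on ℕ^{k+d}: since (p,0) ⊔ (0,x) = (p,x),
the product of the two range projections is the range projection of W_x V_p. -/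
theorem exists_star_V_mul_W (p : Fin k → ℕ) (x : Fin d → ℕ) :
    ∃ c : Circle, star (V Λ p) * W Λ x = (c : ℂ) • (W Λ x * star (V Λ p)) := by
  obtain ⟨c, hc⟩ := exists_V_mul_W Λ p x
  have hn : V Λ p * star (V Λ p) * (W Λ x * star (W Λ x)) =
      W Λ x * V Λ p * star (W Λ x * V Λ p) := by
    have h1 : gen Λ (Fin.append p 0 ⊔ Fin.append 0 x) = gen Λ (Fin.append p x) := by
      rw [append_sup_append]; simp
    have h2 : W Λ x * V Λ p = (sigmaTheta (blockTheta Λ) (Fin.append 0 x) (Fin.append p 0) : ℂ) •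
        gen Λ (Fin.append p x) := by
      rw [V, W, gen_mul, append_add_append, add_zero, zero_add]
    rw [h2, V, W, gen_nica, h1, star_smul, smul_mul_smul_comm, Complex.star_def,
      ← Circle.coe_inv_eq_conj, ← Circle.coe_mul, mul_inv_cancel, Circle.coe_one, one_smul]
  have hc' : W Λ x * V Λ p = ((c⁻¹ : Circle) : ℂ) • (V Λ p * W Λ x) := by
    rw [hc, smul_smul, ← Circle.coe_mul, inv_mul_cancel, Circle.coe_one, one_smul]
  refine ⟨c⁻¹, ?_⟩
  calc star (V Λ p) * W Λ x
      = star (V Λ p) * (V Λ p * star (V Λ p) * (W Λ x * star (W Λ x))) * W Λ x := by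
        rw [mul_assoc, mul_assoc, mul_assoc (W Λ x), W_isometry, mul_one, ← mul_assoc,
          ← mul_assoc, V_isometry, one_mul]
    _ = star (V Λ p) * (W Λ x * V Λ p) * star (V Λ p) * (star (W Λ x) * W Λ x) := by
        rw [hn, star_mul]; simp only [mul_assoc]
    _ = star (V Λ p) * (W Λ x * V Λ p) * star (V Λ p) := by rw [W_isometry, mul_one]
    _ = ((c⁻¹ : Circle) : ℂ) • (W Λ x * star (V Λ p)) := by
        rw [hc', mul_smul_comm, ← mul_assoc, V_isometry, one_mul, smul_mul_assoc]

end ToeplitzTorus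

theorem norm_eq_one_of_star_mul_self {A : Type*} [CStarAlgebra A] [Nontrivial A] {a : A}
    (h : star a * a = 1) : ‖a‖ = 1 := by
  have h1 := CStarRing.norm_star_mul_self (x := a)
  rw [h, CStarRing.norm_one] at h1
  nlinarith [norm_nonneg a]

theorem norm_star_eq_one_of_star_mul_self {A : Type*} [CStarAlgebra A] [Nontrivial A] {a : A}
    (h : star a * a = 1) : ‖star a‖ = 1 := by
  rw [norm_star, norm_eq_one_of_star_mul_self h]

namespace ToeplitzTorus

variable {k d : ℕ} (Λ : Matrix (Fin k) (Fin d) ℝ)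

theorem gen_append (p : Fin k → ℕ) (x : Fin d → ℕ) :
    ∃ c : Circle, gen Λ (Fin.append p x) = (c : ℂ) • (V Λ p * W Λ x) := by
  refine ⟨(Circle.exp (-Real.pi * ((fun i => (p i : ℝ)) ⬝ᵥ Λ.mulVec (fun j => (x j : ℝ)))))⁻¹, ?_⟩
  rw [V_mul_W, smul_smul, ← Circle.coe_mul, inv_mul_cancel, Circle.coe_one, one_smul]

variable {Λ}

/-- Induction over the generators `L_{(p,0)}` and `L_{(0,x)}`, for closed predicates. -/
theorem induction {C : ToeplitzTorus Λ → Prop} (hclosed : IsClosed {a | C a})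
    (V : ∀ p, C (V Λ p)) (star_V : ∀ p, C (star (ToeplitzTorus.V Λ p)))
    (W : ∀ x, C (W Λ x)) (star_W : ∀ x, C (star (ToeplitzTorus.W Λ x)))
    (algebraMap : ∀ c : ℂ, C (algebraMap ℂ _ c)) (add : ∀ a b, C a → C b → C (a + b))
    (mul : ∀ a b, C a → C b → C (a * b)) (a : ToeplitzTorus Λ) : C a := by
  have hgen : ∀ q : Fin (k + d) → ℕ, ∃ p : Fin k → ℕ, ∃ x : Fin d → ℕ, ∃ c : ℂ,
      gen Λ q = c • (ToeplitzTorus.V Λ p * ToeplitzTorus.W Λ x) := fun q => by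
    obtain ⟨c, hc⟩ := gen_append Λ (fun i => q (Fin.castAdd d i)) (fun j => q (Fin.natAdd k j))
    rw [Fin.append_castAdd_natAdd] at hc
    exact ⟨_, _, _, hc⟩
  refine reducedTwisted.induction hclosed (fun q => ?_) (fun q => ?_) algebraMap add mul a
  · obtain ⟨p, x, c, h⟩ := hgen q
    change C (gen Λ q)
    rw [h, Algebra.smul_def]
    exact mul _ _ (algebraMap c) (mul _ _ (V p) (W x))
  · obtain ⟨p, x, c, h⟩ := hgen q
    change C (star (gen Λ q))
    rw [h, star_smul, star_mul, Algebra.smul_def]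
    exact mul _ _ (algebraMap _) (mul _ _ (star_W x) (star_V p))

instance : Nontrivial (ToeplitzTorus Λ) := by
  refine ⟨1, 0, fun h => ?_⟩
  have h1 := congrArg (fun a : ToeplitzTorus Λ =>
    (a : EllTwo (Fin (k + d) → ℕ) →L[ℂ] EllTwo (Fin (k + d) → ℕ)) (deltaVec 0)) h
  have h2 : (deltaVec 0 : EllTwo (Fin (k + d) → ℕ)) = 0 := h1
  have h3 := norm_deltaVec (0 : Fin (k + d) → ℕ)
  rw [h2, norm_zero] at h3
  exact zero_ne_one h3

theorem norm_W_le (x : Fin d → ℕ) : ‖W Λ x‖ ≤ 1 := norm_le_one_of_star_mul_self (W_isometry Λ x)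

/-- The elements that vanish asymptotically on the ranges of the isometries `L_{(0,x)}`. -/
def VanishesAtInfinity (a : ToeplitzTorus Λ) : Prop :=
  Filter.Tendsto (fun x => ‖a * W Λ x‖) Filter.atTop (nhds 0)

/-! ### Elements vanishing at infinity form a closed two-sided ideal -/

namespace VanishesAtInfinity

theorem isClosed : IsClosed {a : ToeplitzTorus Λ | VanishesAtInfinity a} := by
  refine isClosed_of_closure_subset fun a ha => ?_
  refine tendsto_order.2 ⟨fun r hr => Filter.Eventually.of_forall fun x =>
    hr.trans_le (norm_nonneg _), fun ε hε => ?_⟩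
  obtain ⟨b, hb, hab⟩ := Metric.mem_closure_iff.1 ha (ε / 2) (half_pos hε)
  filter_upwards [(tendsto_order.1 (show VanishesAtInfinity b from hb)).2 (ε / 2) (half_pos hε)]
    with x hx
  rw [dist_eq_norm] at hab
  calc ‖a * W Λ x‖ = ‖(a - b) * W Λ x + b * W Λ x‖ := by rw [← add_mul, sub_add_cancel]
    _ ≤ ‖(a - b) * W Λ x‖ + ‖b * W Λ x‖ := norm_add_le _ _
    _ ≤ ‖a - b‖ + ‖b * W Λ x‖ := by
        gcongr
        exact (norm_mul_le _ _).trans (mul_le_of_le_one_right (norm_nonneg _) (norm_W_le x))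
    _ < ε := by linarith

theorem add {a b : ToeplitzTorus Λ} (ha : VanishesAtInfinity a) (hb : VanishesAtInfinity b) :
    VanishesAtInfinity (a + b) := by
  refine squeeze_zero (fun _ => norm_nonneg _) (fun x => ?_)
    (by simpa using Filter.Tendsto.add ha hb)
  rw [add_mul]
  exact norm_add_le _ _

theorem mul_left (b : ToeplitzTorus Λ) {a : ToeplitzTorus Λ} (ha : VanishesAtInfinity a) :
    VanishesAtInfinity (b * a) := by
  refine squeeze_zero (fun _ => norm_nonneg _) (fun x => ?_)
    (by simpa using Filter.Tendsto.const_mul ‖b‖ ha)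
  rw [mul_assoc]
  exact norm_mul_le _ _

theorem mul_right_of_commute {a b : ToeplitzTorus Λ} (ha : VanishesAtInfinity a)
    (hb : ∀ x, ∃ c : Circle, b * W Λ x = (c : ℂ) • (W Λ x * b)) : VanishesAtInfinity (a * b) := by
  refine squeeze_zero (fun _ => norm_nonneg _) (fun x => ?_)
    (by simpa using Filter.Tendsto.mul_const ‖b‖ ha)
  obtain ⟨c, hc⟩ := hb x
  rw [mul_assoc, hc, mul_smul_comm, norm_smul, Circle.norm_coe, one_mul, ← mul_assoc]
  exact norm_mul_le _ _

/-- W_y* need not commute with W_x up to a phase, but for x ≥ y it shifts x to x - y, which still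
tends to infinity. -/
theorem mul_star_W {a : ToeplitzTorus Λ} (ha : VanishesAtInfinity a) (y : Fin d → ℕ) :
    VanishesAtInfinity (a * star (W Λ y)) := by
  have hsub : Filter.Tendsto (fun x : Fin d → ℕ => x - y) Filter.atTop Filter.atTop :=
    Filter.tendsto_atTop.2 fun z => by
      filter_upwards [Filter.eventually_ge_atTop (z + y)] with x hx
      exact le_tsub_of_add_le_right hx
  refine (ha.comp hsub).congr' ?_
  filter_upwards [Filter.eventually_ge_atTop y] with x hx
  have : star (W Λ y) * W Λ x = W Λ (x - y) := by
    conv_lhs => rw [← add_tsub_cancel_of_le hx, W_add, ← mul_assoc, W_isometry, one_mul]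
  rw [Function.comp_apply, mul_assoc, this]

/-- Only generators b matter: V, V* and W commute with every W_x up to a phase, and W* shifts x.
Quantifying over all a in the induction makes the property multiplicative in b. -/
theorem mul_right {a : ToeplitzTorus Λ} (ha : VanishesAtInfinity a) (b : ToeplitzTorus Λ) :
    VanishesAtInfinity (a * b) := by
  refine induction (C := fun b => ∀ a, VanishesAtInfinity a → VanishesAtInfinity (a * b))
    ?_ ?_ ?_ ?_ ?_ ?_ ?_ ?_ b a ha
  · simp only [Set.ofPred_forall]
    exact isClosed_iInter fun a => isClosed_iInter fun _ =>
      isClosed.preimage (continuous_const_mul a)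
  · exact fun p a ha => ha.mul_right_of_commute (exists_V_mul_W Λ p)
  · exact fun p a ha => ha.mul_right_of_commute (exists_star_V_mul_W Λ p)
  · refine fun y a ha => ha.mul_right_of_commute fun x => ⟨1, ?_⟩
    rw [← W_add, ← W_add, add_comm, Circle.coe_one, one_smul]
  · exact fun y a ha => ha.mul_star_W y
  · intro c a ha
    rw [← Algebra.commutes]
    exact ha.mul_left _
  · intro b b' h h' a ha
    rw [mul_add]
    exact (h a ha).add (h' a ha)
  · intro b b' h h' a ha
    rw [← mul_assoc]
    exact h' _ (h a ha)

end VanishesAtInfinity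

theorem defect_eq (j : Fin d) :
    (1 - gen Λ (Pi.single (Fin.natAdd k j) 1) * star (gen Λ (Pi.single (Fin.natAdd k j) 1))) =
      1 - W Λ (Pi.single j 1) * star (W Λ (Pi.single j 1)) := by
  have : (Pi.single (Fin.natAdd k j) 1 : Fin (k + d) → ℕ) = Fin.append 0 (Pi.single j 1) := by
    ext i
    refine Fin.addCases (fun i => ?_) (fun i => ?_) i
    · simp [Pi.single_apply, Fin.ext_iff]
      omega
    · simp [Pi.single_apply, Fin.ext_iff]
  rw [this, W]

/-- For x ≥ e_j the range of W_x lies in that of W_{e_j}, so the product is exactly zero. -/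
theorem vanishesAtInfinity_defect (j : Fin d) :
    VanishesAtInfinity (1 - W Λ (Pi.single j 1) * star (W Λ (Pi.single j 1))) := by
  refine tendsto_const_nhds.congr' ?_
  filter_upwards [Filter.eventually_ge_atTop (Pi.single j 1)] with x hx
  rw [← add_tsub_cancel_of_le hx, W_add, ← mul_assoc, sub_mul, mul_assoc, W_isometry, mul_one,
    one_mul, sub_self, zero_mul, norm_zero]

theorem vanishesAtInfinity_of_mem {a : ToeplitzTorus Λ} (ha : a ∈ defectIdeal Λ) :
    VanishesAtInfinity a := by
  refine VanishesAtInfinity.isClosed.closure_subset_iff.2 (fun b hb => ?_) ha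
  have hb' : b ∈ TwoSidedIdeal.span (defectProjections Λ) := TwoSidedIdeal.mem_asIdeal.1 hb
  change VanishesAtInfinity b
  clear hb ha
  induction hb' using TwoSidedIdeal.span_induction with
  | mem x h =>
    obtain ⟨j, rfl⟩ := h
    simp only [defect_eq]
    exact vanishesAtInfinity_defect j
  | zero => simp [VanishesAtInfinity]
  | add x y _ _ hx hy => exact hx.add hy
  | neg x _ hx => simpa using hx.mul_left (-1)
  | left_absorb a x _ hx => exact hx.mul_left a
  | right_absorb a x _ hx => exact hx.mul_right a

theorem defectProjections_subset : defectProjections Λ ⊆ defectIdeal Λ := fun _ ha =>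
  subset_closure (TwoSidedIdeal.mem_asIdeal.2 (TwoSidedIdeal.subset_span ha))

variable (Λ) in
theorem one_sub_W_mem (x : Fin d → ℕ) : 1 - W Λ x * star (W Λ x) ∈ defectIdeal Λ := by
  let M : AddSubmonoid (Fin d → ℕ) :=
    { carrier := {x | 1 - W Λ x * star (W Λ x) ∈ defectIdeal Λ}
      zero_mem' := by simp [W_zero]
      add_mem' := fun {x y} hx hy => by
        -- This telescoping identity reduces the claim to the unit vectors, which generate ℕᵈ.
        have : 1 - W Λ (x + y) * star (W Λ (x + y)) = (1 - W Λ x * star (W Λ x)) +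
            W Λ x * (1 - W Λ y * star (W Λ y)) * star (W Λ x) := by
          rw [W_add, star_mul]
          noncomm_ring
        change 1 - W Λ (x + y) * star (W Λ (x + y)) ∈ defectIdeal Λ
        rw [this]
        exact add_mem hx (Ideal.IsTwoSided.mul_mem_of_left _ (Ideal.mul_mem_left _ _ hy)) }
  change x ∈ M
  rw [← Finset.univ_sum_single x]
  refine sum_mem fun j _ => ?_
  have : (Pi.single j (x j) : Fin d → ℕ) = x j • Pi.single j 1 := by
    rw [← Pi.single_smul, smul_eq_mul, mul_one]
  rw [this]
  refine nsmul_mem ?_ _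
  change _ ∈ defectIdeal Λ
  rw [← defect_eq]
  exact defectProjections_subset ⟨j, rfl⟩

variable (Λ) in
-- The witness is e = W_x W_x* for a single large x: ‖a e‖ ≤ ‖a W_x‖, and 1 - e lies in the ideal.
theorem exists_approximateUnit : ∀ a ∈ defectIdeal Λ, ∀ ε > (0 : ℝ),
    ∃ e : ToeplitzTorus Λ, ‖e‖ ≤ 1 ∧ 1 - e ∈ defectIdeal Λ ∧ ‖a * e‖ ≤ ε := by
  intro a ha ε hε
  obtain ⟨x, hx⟩ := ((tendsto_order.1 (vanishesAtInfinity_of_mem ha)).2 ε hε).exists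
  have hs : ‖star (W Λ x)‖ ≤ 1 := 
    (norm_star_eq_one_of_star_mul_self (W_isometry Λ x)).le
  refine ⟨W Λ x * star (W Λ x), ?_, one_sub_W_mem Λ x, ?_⟩
  · exact (norm_mul_le _ _).trans (mul_le_one₀ (norm_W_le x) (norm_nonneg _) hs)
  · rw [← mul_assoc]
    exact ((norm_mul_le _ _).trans (mul_le_of_le_one_right (norm_nonneg _) hs)).trans hx.le

theorem one_notMem_defectIdeal : (1 : ToeplitzTorus Λ) ∉ defectIdeal Λ := by
  intro h
  obtain ⟨x, hx⟩ := ((tendsto_order.1 (vanishesAtInfinity_of_mem h)).2 1 one_pos).exists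
  rw [one_mul, norm_eq_one_of_star_mul_self (W_isometry Λ x)] at hx
  exact lt_irrefl _ hx

end ToeplitzTorus

/-- The quotient `𝒯_r(ℕ^{k+d}, σ_Θ) / I` is a C*-algebra. -/
@[reducible]
noncomputable def ToeplitzQuotient.cstarAlgebra {k d : ℕ} (Λ : Matrix (Fin k) (Fin d) ℝ) :
    CStarAlgebra (ToeplitzQuotient Λ) :=
  Ideal.Quotient.cstarAlgebraOfApproximateUnit _ (ToeplitzTorus.exists_approximateUnit Λ)

instance ToeplitzQuotient.nontrivial {k d : ℕ} (Λ : Matrix (Fin k) (Fin d) ℝ) :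
    Nontrivial (ToeplitzQuotient Λ) :=
  Ideal.Quotient.nontrivial_iff.2
    ((Ideal.ne_top_iff_one _).2 ToeplitzTorus.one_notMem_defectIdeal)

/-! ### Extending unitary representations from ℕᵈ to ℤᵈ -/

section ofNat

variable {k d : ℕ} {Λ : Matrix (Fin k) (Fin d) ℝ}

/-- The coordinatewise positive part of an integer vector. -/
def posVec {d : ℕ} (x : Fin d → ℤ) : Fin d → ℕ := fun j => (x j).toNat

theorem posVec_natCast (x : Fin d → ℕ) : posVec (fun j => (x j : ℤ)) = x := by
  ext j; simp [posVec]

theorem posVec_neg_natCast (x : Fin d → ℕ) : posVec (-fun j => (x j : ℤ)) = 0 := by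
  ext j; simp [posVec]

theorem posVec_zero : posVec (0 : Fin d → ℤ) = 0 := by ext j; simp [posVec]

/-- Positive parts are not additive; this identity is the substitute that makes w(x⁺) w(x⁻)*
multiplicative. -/
theorem add_posVec_add (x y : Fin d → ℤ) :
    posVec (x + y) + (posVec (-x) + posVec (-y)) = posVec (-(x + y)) + (posVec x + posVec y) := by
  ext j
  simp only [posVec, Pi.add_apply, Pi.neg_apply]
  omega

theorem posVec_eq_posVec_neg_iff {x : Fin d → ℤ} : posVec x = posVec (-x) ↔ x = 0 := by
  simp only [funext_iff, posVec, Pi.neg_apply, Pi.zero_apply]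
  exact forall_congr' fun j => by omega

variable {A : Type*} [CStarAlgebra A]

/-- A unitary representation `w` of `ℕᵈ` extends to `ℤᵈ` by `x ↦ w(x⁺) w(x⁻)*`; a pair on
`ℕᵏ` and `ℕᵈ` thus extends to a pair on `ℕᵏ` and `ℤᵈ`. -/
noncomputable def NicaUnitaryPair.ofNat (v : (Fin k → ℕ) → A) (w : (Fin d → ℕ) → A)
    (v_zero : v 0 = 1) (v_add : ∀ p q, v (p + q) = v p * v q)
    (v_isometry : ∀ p, star (v p) * v p = 1)
    (v_nica : ∀ p q, v p * star (v p) * (v q * star (v q)) = v (p ⊔ q) * star (v (p ⊔ q)))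
    (w_zero : w 0 = 1) (w_add : ∀ x y, w (x + y) = w x * w y)
    (w_isometry : ∀ x, star (w x) * w x = 1) (w_coisometry : ∀ x, w x * star (w x) = 1)
    (w_mul_v : ∀ x p, w x * v p = Complex.exp (2 * Real.pi * Complex.I *
      (((fun i => (p i : ℝ)) ⬝ᵥ Λ.mulVec (fun j => (x j : ℝ)) : ℝ) : ℂ)) • (v p * w x)) :
    NicaUnitaryPair Λ A where
  v := v
  u x := w (posVec x) * star (w (posVec (-x)))
  v_zero := v_zero
  v_add := v_add
  v_isometry := v_isometry
  v_nica := v_nica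
  u_zero := by simp [posVec_zero, w_zero]
  u_add x y := by
    have hcomm : ∀ a b, w a * w b = w b * w a := fun a b => by rw [← w_add, ← w_add, add_comm]
    have hstar : ∀ a b, star (w a) * w b = w b * star (w a) := fun a b => by
      calc star (w a) * w b = star (w a) * (w b * w a) * star (w a) := by
            rw [mul_assoc, mul_assoc, w_coisometry, mul_one]
        _ = w b * star (w a) := by rw [hcomm, ← mul_assoc, w_isometry, one_mul]
    -- w_a w_b* depends only on the difference a - b.
    have hdiff : ∀ a b a' b', a + b' = a' + b → w a * star (w b) = w a' * star (w b') := by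
      intro a b a' b' h
      have h1 : w a * w b' = w a' * w b := by rw [← w_add, h, w_add]
      calc w a * star (w b) = (w a * w b') * star (w b') * star (w b) := by
            rw [mul_assoc (w a), w_coisometry, mul_one]
        _ = w a' * (w b * star (w b')) * star (w b) := by rw [h1, mul_assoc (w a')]
        _ = w a' * star (w b') := by
            rw [← hstar, ← mul_assoc, mul_assoc, w_coisometry, mul_one]
    calc w (posVec (x + y)) * star (w (posVec (-(x + y))))
        = w (posVec x + posVec y) * star (w (posVec (-x) + posVec (-y))) :=
          hdiff _ _ _ _ ((add_posVec_add x y).trans (add_comm _ _))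
      _ = w (posVec x) * (w (posVec y) * star (w (posVec (-x)))) * star (w (posVec (-y))) := by
          rw [w_add, add_comm, w_add, star_mul]
          simp only [mul_assoc]
      _ = _ := by rw [← hstar]; simp only [mul_assoc]
  u_unitary x := by
    have hw : ∀ a, w a ∈ unitary A := fun a => Unitary.mem_iff.2 ⟨w_isometry a, w_coisometry a⟩
    exact mul_mem (hw _) (Unitary.star_mem (hw _))
  u_mul_v x p := by
    set χ : (Fin d → ℝ) → ℂ := fun y => 2 * Real.pi * Complex.I *
      (((fun i => (p i : ℝ)) ⬝ᵥ Λ.mulVec y : ℝ) : ℂ) with hχ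
    have hw : ∀ y : Fin d → ℕ, w y * v p = Complex.exp (χ fun j => (y j : ℝ)) • (v p * w y) :=
      fun y => w_mul_v y p
    have hstar : ∀ y : Fin d → ℕ,
        star (w y) * v p = Complex.exp (-χ fun j => (y j : ℝ)) • (v p * star (w y)) := fun y => by
      have : v p * star (w y) = Complex.exp (χ fun j => (y j : ℝ)) • (star (w y) * v p) := by
        calc v p * star (w y) = star (w y) * (w y * v p) * star (w y) := by
              rw [← mul_assoc, w_isometry, one_mul]
          _ = Complex.exp (χ fun j => (y j : ℝ)) • (star (w y) * v p * (w y * star (w y))) := by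
              rw [hw]; simp only [mul_smul_comm, smul_mul_assoc, mul_assoc]
          _ = _ := by rw [w_coisometry, mul_one]
      rw [this, smul_smul, ← Complex.exp_add, neg_add_cancel, Complex.exp_zero, one_smul]
    have hsub : (χ fun j => (x j : ℝ)) =
        -(χ fun j => (posVec (-x) j : ℝ)) + χ fun j => (posVec x j : ℝ) := by
      have : (fun j => (x j : ℝ)) =
          (fun j => (posVec x j : ℝ)) - fun j => (posVec (-x) j : ℝ) := by
        ext j
        have h : x j = ((x j).toNat : ℤ) - ((-x j).toNat : ℤ) := by omega
        simp only [posVec, Pi.sub_apply, Pi.neg_apply]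
        exact_mod_cast h
      rw [this]
      simp only [hχ, Matrix.mulVec_sub, dotProduct_sub]
      push_cast
      ring
    change _ = Complex.exp (χ fun j => (x j : ℝ)) • _
    rw [mul_assoc, hstar, mul_smul_comm, ← mul_assoc, hw, smul_mul_assoc, smul_smul,
      ← Complex.exp_add, ← hsub, mul_assoc]

theorem NicaUnitaryPair.u_eq_mul_star (r : NicaUnitaryPair Λ A) (x : Fin d → ℤ) :
    r.u x = r.u (fun j => (posVec x j : ℤ)) * star (r.u fun j => (posVec (-x) j : ℤ)) := by
  rw [r.star_u, ← r.u_add]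
  congr 1
  ext j
  simp only [posVec, Pi.add_apply, Pi.neg_apply]
  omega

/-- Transport of a pair to the lift of its C*-algebra to a larger universe. -/
noncomputable def NicaUnitaryPair.ulift (r : NicaUnitaryPair Λ A) :
    letI := ULift.cstarAlgebraOf.{w} A
    NicaUnitaryPair Λ (ULift.{w} A) :=
  letI := ULift.cstarAlgebraOf.{w} A
  { v := fun p => ⟨r.v p⟩
    u := fun x => ⟨r.u x⟩
    v_zero := ULift.ext _ _ r.v_zero
    v_add := fun p q => ULift.ext _ _ (r.v_add p q)
    v_isometry := fun p => ULift.ext _ _ (r.v_isometry p)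
    v_nica := fun p q => ULift.ext _ _ (r.v_nica p q)
    u_zero := ULift.ext _ _ r.u_zero
    u_add := fun x y => ULift.ext _ _ (r.u_add x y)
    u_unitary := fun x => Unitary.mem_iff.2
      ⟨ULift.ext _ _ (Unitary.star_mul_self_of_mem (r.u_unitary x)),
        ULift.ext _ _ (Unitary.mul_star_self_of_mem (r.u_unitary x))⟩
    u_mul_v := fun x p => ULift.ext _ _ (r.u_mul_v x p) }

/-- The universal property of `B_Λ` for C*-algebras in the lowest universe. -/
theorem BLambda.exists_lift_type {Q : Type} [CStarAlgebra Q] [Nontrivial Q]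
    (r : NicaUnitaryPair Λ Q) :
    ∃ φ : BLambda.{w} Λ →⋆ₐ[ℂ] Q,
      (∀ p, φ ((BLambda.pair Λ).v p) = r.v p) ∧ (∀ x, φ ((BLambda.pair Λ).u x) = r.u x) := by
  -- The universal property tests algebras in universe `w`, whereas `Q` lies in `Type`.
  let _ := ULift.cstarAlgebraOf.{w} Q
  obtain ⟨φ, ⟨hv, hu⟩, -⟩ := BLambda.existsUnique_lift.{w} Λ (A := ULift.{w} Q) r.ulift
  let down : ULift.{w} Q →⋆ₐ[ℂ] Q :=
    { toFun := ULift.down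
      map_one' := rfl
      map_mul' := fun _ _ => rfl
      map_zero' := rfl
      map_add' := fun _ _ => rfl
      commutes' := fun _ => rfl
      map_star' := fun _ => rfl }
  exact ⟨down.comp φ, fun p => congrArg ULift.down (hv p), fun x => congrArg ULift.down (hu x)⟩

end ofNat

/-! ### The canonical pair in the quotient -/

namespace ToeplitzQuotient

attribute [local instance] ToeplitzQuotient.cstarAlgebra

variable {k d : ℕ} (Λ : Matrix (Fin k) (Fin d) ℝ)

/-- The canonical pair in the quotient `𝒯_r(ℕ^{k+d}, σ_Θ) / I`. -/
noncomputable def pair : NicaUnitaryPair Λ (ToeplitzQuotient Λ) :=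
  NicaUnitaryPair.ofNat (fun p => Ideal.Quotient.mk (defectIdeal Λ) (ToeplitzTorus.V Λ p))
    (fun x => Ideal.Quotient.mk (defectIdeal Λ) (ToeplitzTorus.W Λ x))
    (congrArg _ (ToeplitzTorus.V_zero Λ))
    (fun p q => congrArg (Ideal.Quotient.mk (defectIdeal Λ)) (ToeplitzTorus.V_add Λ p q))
    (fun p => congrArg (Ideal.Quotient.mk (defectIdeal Λ)) (ToeplitzTorus.V_isometry Λ p))
    (fun p q => congrArg (Ideal.Quotient.mk (defectIdeal Λ)) (ToeplitzTorus.V_nica Λ p q))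
    (congrArg _ (ToeplitzTorus.W_zero Λ))
    (fun x y => congrArg (Ideal.Quotient.mk (defectIdeal Λ)) (ToeplitzTorus.W_add Λ x y))
    (fun x => congrArg (Ideal.Quotient.mk (defectIdeal Λ)) (ToeplitzTorus.W_isometry Λ x))
    (fun x => (Ideal.Quotient.eq.2 (ToeplitzTorus.one_sub_W_mem Λ x)).symm)
    (fun x p => congrArg (Ideal.Quotient.mk (defectIdeal Λ)) (ToeplitzTorus.W_mul_V Λ x p))

theorem pair_u (x : Fin d → ℤ) :
    (pair Λ).u x = Ideal.Quotient.mk (defectIdeal Λ)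
      (ToeplitzTorus.W Λ (posVec x) * star (ToeplitzTorus.W Λ (posVec (-x)))) := rfl

theorem pair_u_natCast (x : Fin d → ℕ) :
    (pair Λ).u (fun j => (x j : ℤ)) =
      Ideal.Quotient.mk (defectIdeal Λ) (ToeplitzTorus.W Λ x) := by
  rw [pair_u, posVec_natCast, posVec_neg_natCast, ToeplitzTorus.W_zero, star_one, mul_one]

end ToeplitzQuotient

/-! ### Diagonal matrix coefficients and their limits at infinity -/

namespace ToeplitzTorus

variable {k d : ℕ} {Λ : Matrix (Fin k) (Fin d) ℝ}

/-- The diagonal matrix coefficient `⟨δ_(q,y), a δ_(q,y)⟩`. -/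
noncomputable def diagCoeff (q : Fin k → ℕ) (y : Fin d → ℕ) : ToeplitzTorus Λ →ₗ[ℂ] ℂ where
  toFun a := inner ℂ (deltaVec (Fin.append q y) : EllTwo (Fin (k + d) → ℕ))
    ((a : EllTwo (Fin (k + d) → ℕ) →L[ℂ] EllTwo (Fin (k + d) → ℕ)) (deltaVec (Fin.append q y)))
  map_add' a b := by
    simp only [AddMemClass.coe_add, add_apply, inner_add_right]
  map_smul' c a := by
    simp only [SetLike.val_smul, smul_apply, inner_smul_right, smul_eq_mul,
      RingHom.id_apply]

theorem norm_apply_deltaVec_le (a : ToeplitzTorus Λ) (r : Fin (k + d) → ℕ) :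
    ‖(a : EllTwo (Fin (k + d) → ℕ) →L[ℂ] EllTwo (Fin (k + d) → ℕ)) (deltaVec r)‖ ≤ ‖a‖ := by
  have := (a : EllTwo (Fin (k + d) → ℕ) →L[ℂ] EllTwo (Fin (k + d) → ℕ)).le_opNorm (deltaVec r)
  rwa [norm_deltaVec, mul_one] at this

theorem norm_diagCoeff_le (q : Fin k → ℕ) (y : Fin d → ℕ) (a : ToeplitzTorus Λ) :
    ‖diagCoeff q y a‖ ≤ ‖(a : EllTwo (Fin (k + d) → ℕ) →L[ℂ] EllTwo (Fin (k + d) → ℕ))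
      (deltaVec (Fin.append q y))‖ := by
  have := norm_inner_le_norm (𝕜 := ℂ) (deltaVec (Fin.append q y) : EllTwo (Fin (k + d) → ℕ))
    ((a : EllTwo (Fin (k + d) → ℕ) →L[ℂ] EllTwo (Fin (k + d) → ℕ)) (deltaVec (Fin.append q y)))
  rwa [norm_deltaVec, one_mul] at this

/-- δ_{(q,y)} is a unimodular multiple of W_y δ_{(q,0)}, so decay of a W_y forces decay of the
coefficients of a. -/
theorem norm_diagCoeff_le_norm_mul_W (q : Fin k → ℕ) (y : Fin d → ℕ) (a : ToeplitzTorus Λ) :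
    ‖diagCoeff q y a‖ ≤ ‖a * W Λ y‖ := by
  refine (norm_diagCoeff_le q y a).trans ?_
  have h : ((a * W Λ y : ToeplitzTorus Λ) : EllTwo (Fin (k + d) → ℕ) →L[ℂ]
      EllTwo (Fin (k + d) → ℕ)) (deltaVec (Fin.append q 0)) =
      (sigmaTheta (blockTheta Λ) (Fin.append 0 y) (Fin.append q 0) : ℂ) •
        (a : EllTwo (Fin (k + d) → ℕ) →L[ℂ] EllTwo (Fin (k + d) → ℕ))
          (deltaVec (Fin.append q y)) := by
    change (a : EllTwo (Fin (k + d) → ℕ) →L[ℂ] EllTwo (Fin (k + d) → ℕ))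
      (leftRegular _ (Fin.append 0 y) _) = _
    rw [leftRegular_deltaVec, map_smul, append_add_append, zero_add, add_zero]
  have h2 := norm_apply_deltaVec_le (a * W Λ y) (Fin.append q 0)
  rwa [h, norm_smul, Circle.norm_coe, one_mul] at h2

theorem tendsto_diagCoeff_of_mem (q : Fin k → ℕ) {a : ToeplitzTorus Λ} (ha : a ∈ defectIdeal Λ) :
    Filter.Tendsto (fun y => diagCoeff q y a) Filter.atTop (nhds 0) :=
  squeeze_zero_norm (fun y => norm_diagCoeff_le_norm_mul_W q y a) (vanishesAtInfinity_of_mem ha)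

variable (Λ) in
/-- The lift of the monomial `v_p v_q* u_x` to `𝒯_r(ℕ^{k+d}, σ_Θ)`. -/
noncomputable def mono (m : (Fin k → ℕ) × (Fin k → ℕ) × (Fin d → ℤ)) : ToeplitzTorus Λ :=
  V Λ m.1 * star (V Λ m.2.1) * (W Λ (posVec m.2.2) * star (W Λ (posVec (-m.2.2))))

theorem exists_star_leftRegular_deltaVec {n : ℕ} (Θ : Matrix (Fin n) (Fin n) ℝ)
    (p r : Fin n → ℕ) : ∃ c : ℂ, (c ≠ 0 → p ≤ r) ∧
      star (leftRegular (sigmaTheta Θ) p) (deltaVec r) = c • deltaVec (r - p) := by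
  by_cases h : p ≤ r
  · exact ⟨_, fun _ => h, star_leftRegular_deltaVec_of_le Θ h⟩
  · exact ⟨0, fun h0 => absurd rfl h0, by rw [star_leftRegular_deltaVec_of_not_le Θ h, zero_smul]⟩

theorem exists_V_deltaVec (p q : Fin k → ℕ) (y : Fin d → ℕ) :
    ∃ c : ℂ, (V Λ p : EllTwo (Fin (k + d) → ℕ) →L[ℂ] EllTwo (Fin (k + d) → ℕ))
      (deltaVec (Fin.append q y)) = c • deltaVec (Fin.append (p + q) y) := by
  refine ⟨sigmaTheta (blockTheta Λ) (Fin.append p 0) (Fin.append q y),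
    (leftRegular_deltaVec _ _ _).trans ?_⟩
  rw [append_add_append, zero_add]

theorem exists_W_deltaVec (x : Fin d → ℕ) (q : Fin k → ℕ) (y : Fin d → ℕ) :
    ∃ c : ℂ, (W Λ x : EllTwo (Fin (k + d) → ℕ) →L[ℂ] EllTwo (Fin (k + d) → ℕ))
      (deltaVec (Fin.append q y)) = c • deltaVec (Fin.append q (x + y)) := by
  refine ⟨sigmaTheta (blockTheta Λ) (Fin.append 0 x) (Fin.append q y),
    (leftRegular_deltaVec _ _ _).trans ?_⟩
  rw [append_add_append, zero_add]

theorem exists_star_V_deltaVec (p q : Fin k → ℕ) (y : Fin d → ℕ) :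
    ∃ c : ℂ, (c ≠ 0 → p ≤ q) ∧
      ((star (V Λ p) : ToeplitzTorus Λ) : EllTwo (Fin (k + d) → ℕ) →L[ℂ]
        EllTwo (Fin (k + d) → ℕ)) (deltaVec (Fin.append q y)) =
          c • deltaVec (Fin.append (q - p) y) := by
  obtain ⟨c, hc, h⟩ := exists_star_leftRegular_deltaVec (blockTheta Λ) (Fin.append p 0)
    (Fin.append q y)
  refine ⟨c, fun h0 => (append_le_append.1 (hc h0)).1, h.trans ?_⟩
  rw [append_sub_append, tsub_zero]

theorem exists_star_W_deltaVec (x : Fin d → ℕ) (q : Fin k → ℕ) (y : Fin d → ℕ) :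
    ∃ c : ℂ, ((star (W Λ x) : ToeplitzTorus Λ) : EllTwo (Fin (k + d) → ℕ) →L[ℂ]
        EllTwo (Fin (k + d) → ℕ)) (deltaVec (Fin.append q y)) =
          c • deltaVec (Fin.append q (y - x)) := by
  obtain ⟨c, -, h⟩ := exists_star_leftRegular_deltaVec (blockTheta Λ) (Fin.append 0 x)
    (Fin.append q y)
  refine ⟨c, h.trans ?_⟩
  rw [append_sub_append, tsub_zero]

theorem exists_mono_deltaVec (p p' : Fin k → ℕ) (x : Fin d → ℤ) (q : Fin k → ℕ)
    (y : Fin d → ℕ) :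
    ∃ c : ℂ, (c ≠ 0 → p' ≤ q) ∧
      (mono Λ (p, p', x) : EllTwo (Fin (k + d) → ℕ) →L[ℂ] EllTwo (Fin (k + d) → ℕ))
        (deltaVec (Fin.append q y)) =
          c • deltaVec (Fin.append (p + (q - p')) (posVec x + (y - posVec (-x)))) := by
  obtain ⟨c₁, h1⟩ := exists_star_W_deltaVec (Λ := Λ) (posVec (-x)) q y
  obtain ⟨c₂, h2⟩ := exists_W_deltaVec (Λ := Λ) (posVec x) q (y - posVec (-x))
  obtain ⟨c₃, hc, h3⟩ := exists_star_V_deltaVec (Λ := Λ) p' q (posVec x + (y - posVec (-x)))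
  obtain ⟨c₄, h4⟩ := exists_V_deltaVec (Λ := Λ) p (q - p') (posVec x + (y - posVec (-x)))
  refine ⟨c₁ * (c₂ * (c₃ * c₄)), fun h0 => hc fun h => h0 (by simp [h]), ?_⟩
  simp only [mono, MulMemClass.coe_mul, mul_apply_eq_comp, h1, h2, h3, h4, map_smul, smul_smul,
    mul_assoc]

/-- A monomial sends δ_{(q,y)} to a multiple of the basis vector shifted by its degree. The
condition on y prevents truncation in y - x⁻; in the other block a nonzero coefficient already
forces p' ≤ q. -/
theorem diagCoeff_mono_of_ne {m : (Fin k → ℕ) × (Fin k → ℕ) × (Fin d → ℤ)}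
    (hm : monoDegree m ≠ 0) (q : Fin k → ℕ) {y : Fin d → ℕ} (hy : posVec (-m.2.2) ≤ y) :
    diagCoeff q y (mono Λ m) = 0 := by
  obtain ⟨p, p', x⟩ := m
  obtain ⟨c, hc, h⟩ := exists_mono_deltaVec (Λ := Λ) p p' x q y
  refine (congrArg (inner ℂ (deltaVec (Fin.append q y))) h).trans ?_
  rw [inner_smul_right, inner_deltaVec]
  by_cases hc0 : c = 0
  · rw [hc0, zero_mul]
  rw [if_neg, mul_zero]
  intro heq
  obtain ⟨h5, h6⟩ := append_inj.1 heq
  have h7 := hc hc0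
  refine hm (monoDegree_eq_zero_iff.2 ⟨?_, ?_⟩)
  · ext i
    have h8 := congrFun h5 i
    have h9 := h7 i
    change q i = p i + (q i - p' i) at h8
    change p' i ≤ q i at h9
    change p i = p' i
    omega
  · refine posVec_eq_posVec_neg_iff.1 ?_
    ext j
    have h8 := congrFun h6 j
    have h9 := hy j
    change y j = posVec x j + (y j - posVec (-x) j) at h8
    change posVec x j = posVec (-x) j
    change posVec (-x) j ≤ y j at h9
    omega

open Classical in
theorem diagCoeff_mono_of_eq {m : (Fin k → ℕ) × (Fin k → ℕ) × (Fin d → ℤ)}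
    (hm : monoDegree m = 0) (q : Fin k → ℕ) (y : Fin d → ℕ) :
    diagCoeff q y (mono Λ m) = if m.1 ≤ q then 1 else 0 := by
  obtain ⟨p, p', x⟩ := m
  obtain ⟨h1, h2⟩ := monoDegree_eq_zero_iff.1 hm
  obtain rfl : p = p' := h1
  obtain rfl : x = 0 := h2
  have : mono Λ (p, p, 0) = V Λ p * star (V Λ p) := by
    simp [mono, posVec_zero, W_zero]
  rw [this]
  change inner ℂ _ ((leftRegular (sigmaTheta (blockTheta Λ)) (Fin.append p 0) *
    star (leftRegular (sigmaTheta (blockTheta Λ)) (Fin.append p 0)))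
      (deltaVec (Fin.append q y))) = _
  rw [leftRegular_mul_star_deltaVec]
  simp only [append_le_append, zero_le, and_true]
  split_ifs
  · rw [inner_deltaVec, if_pos rfl]
  · rw [inner_zero_right]

open Classical in
theorem tendsto_diagCoeff_mono (m : (Fin k → ℕ) × (Fin k → ℕ) × (Fin d → ℤ)) (q : Fin k → ℕ) :
    Filter.Tendsto (fun y => diagCoeff q y (mono Λ m)) Filter.atTop
      (nhds (if monoDegree m = 0 ∧ m.1 ≤ q then 1 else 0)) := by
  refine tendsto_const_nhds.congr' ?_
  filter_upwards [Filter.eventually_ge_atTop (posVec (-m.2.2))] with y hy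
  by_cases hm : monoDegree m = 0
  · rw [diagCoeff_mono_of_eq hm]; simp [hm]
  · rw [diagCoeff_mono_of_ne hm q hy]; simp [hm]

open Classical in
-- The limit of the diagonal coefficients at δ_{(q,y)} depends only on the class modulo the ideal,
-- so it may be computed on a representative of nearly minimal norm, which bounds every coefficient.
theorem norm_sum_diagonal_le (s : Finset ((Fin k → ℕ) × (Fin k → ℕ) × (Fin d → ℤ)))
    (c : (Fin k → ℕ) × (Fin k → ℕ) × (Fin d → ℤ) → ℂ) (q : Fin k → ℕ) :
    ‖∑ m ∈ s with monoDegree m = 0 ∧ m.1 ≤ q, c m‖ ≤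
      ‖Ideal.Quotient.mk (defectIdeal Λ) (∑ m ∈ s, c m • mono Λ m)‖ := by
  refine le_of_forall_pos_le_add fun ε hε => ?_
  obtain ⟨a, ha, halt⟩ := Ideal.Quotient.exists_mk_eq_norm_lt (defectIdeal Λ)
    (Ideal.Quotient.mk (defectIdeal Λ) (∑ m ∈ s, c m • mono Λ m)) hε
  refine le_trans ?_ halt.le
  have hlim : Filter.Tendsto (fun y => diagCoeff q y a) Filter.atTop
      (nhds (∑ m ∈ s with monoDegree m = 0 ∧ m.1 ≤ q, c m)) := by
    have h1 := tendsto_diagCoeff_of_mem q (Ideal.Quotient.eq.1 ha)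
    have h2 := tendsto_finsetSum s fun m _ => (tendsto_diagCoeff_mono (Λ := Λ) m q).const_mul (c m)
    have h3 := h1.add h2
    rw [zero_add] at h3
    convert h3 using 2 with y
    · simp only [map_sub, map_sum, map_smul, smul_eq_mul, sub_add_cancel]
    · rw [Finset.sum_filter]
      simp
  refine le_of_tendsto hlim.norm (Filter.Eventually.of_forall fun y => ?_)
  exact (norm_diagCoeff_le q y a).trans (norm_apply_deltaVec_le a _)

end ToeplitzTorus

/-! ### The isomorphism: injectivity, surjectivity, uniqueness -/

section isomorphism

attribute [local instance] ToeplitzQuotient.cstarAlgebra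

theorem StarAlgEquiv.exists_starAlgHom {A B : Type*} [CStarAlgebra A] [CStarAlgebra B]
    (e : A ≃⋆ₐ[ℂ] B) : ∃ ψ : A →⋆ₐ[ℂ] B, ∀ a, ψ a = e a :=
  ⟨{ toFun := e
     map_one' := map_one e
     map_mul' := map_mul e
     map_zero' := map_zero e
     map_add' := map_add e
     commutes' := fun c => by
      rw [Algebra.algebraMap_eq_smul_one, Algebra.algebraMap_eq_smul_one, map_smul, map_one]
     map_star' := map_star e }, fun _ => rfl⟩

variable {k d : ℕ} {Λ : Matrix (Fin k) (Fin d) ℝ}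

theorem NicaUnitaryPair.map_mono {A B : Type*} [CStarAlgebra A] [CStarAlgebra B]
    (r : NicaUnitaryPair Λ A) (s : NicaUnitaryPair Λ B) (φ : A →⋆ₐ[ℂ] B)
    (hv : ∀ p, φ (r.v p) = s.v p) (hu : ∀ x, φ (r.u x) = s.u x)
    (m : (Fin k → ℕ) × (Fin k → ℕ) × (Fin d → ℤ)) : φ (r.mono m) = s.mono m := by
  simp only [mono, map_mul, map_star, hv, hu]

variable (Λ) in
/-- The quotient map as a `*`-homomorphism of C*-algebras. -/
noncomputable def ToeplitzQuotient.mkHom : ToeplitzTorus Λ →⋆ₐ[ℂ] ToeplitzQuotient Λ where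
  toFun := Ideal.Quotient.mk (defectIdeal Λ)
  map_one' := rfl
  map_mul' _ _ := rfl
  map_zero' := rfl
  map_add' _ _ := rfl
  commutes' _ := rfl
  map_star' _ := rfl

theorem ToeplitzQuotient.mk_sum_smul_mono
    (s : Finset ((Fin k → ℕ) × (Fin k → ℕ) × (Fin d → ℤ)))
    (c : (Fin k → ℕ) × (Fin k → ℕ) × (Fin d → ℤ) → ℂ) :
    ToeplitzQuotient.mkHom Λ (∑ m ∈ s, c m • ToeplitzTorus.mono Λ m) =
      ∑ m ∈ s, c m • (ToeplitzQuotient.pair Λ).mono m := by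
  rw [map_sum]
  rfl

theorem BLambda.injective_of_map_pair (φ : BLambda.{w} Λ →⋆ₐ[ℂ] ToeplitzQuotient Λ)
    (hv : ∀ p, φ ((BLambda.pair Λ).v p) = (ToeplitzQuotient.pair Λ).v p)
    (hu : ∀ x, φ ((BLambda.pair Λ).u x) = (ToeplitzQuotient.pair Λ).u x) :
    Function.Injective φ := by
  classical
  refine BLambda.injective_of_norm_diagonal_le φ fun c q => ?_
  have h : φ (∑ m ∈ c.support, c m • (BLambda.pair.{w} Λ).mono m) =
      ToeplitzQuotient.mkHom Λ (∑ m ∈ c.support, c m • ToeplitzTorus.mono Λ m) := by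
    rw [ToeplitzQuotient.mk_sum_smul_mono, map_sum]
    refine Finset.sum_congr rfl fun m _ => ?_
    rw [map_smul, NicaUnitaryPair.map_mono _ _ φ hv hu]
  rw [h]
  convert ToeplitzTorus.norm_sum_diagonal_le c.support c q <;> rfl

theorem BLambda.surjective_of_map_pair (φ : BLambda.{w} Λ →⋆ₐ[ℂ] ToeplitzQuotient Λ)
    (hv : ∀ p, φ ((BLambda.pair Λ).v p) = (ToeplitzQuotient.pair Λ).v p)
    (hu : ∀ x, φ ((BLambda.pair Λ).u x) = (ToeplitzQuotient.pair Λ).u x) :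
    Function.Surjective φ := by
  have hiso : Isometry φ := AddMonoidHomClass.isometry_of_norm φ fun b =>
    NonUnitalStarAlgHom.norm_map φ (BLambda.injective_of_map_pair φ hv hu) b
  -- Closedness of the range is what allows the induction on generators to reach the whole closure.
  have hrange : IsClosed (Set.range φ) := hiso.isClosedEmbedding.isClosed_range
  have hW : ∀ x, φ ((BLambda.pair Λ).u fun j => (x j : ℤ)) =
      ToeplitzQuotient.mkHom Λ (ToeplitzTorus.W Λ x) := fun x =>
    (hu _).trans (ToeplitzQuotient.pair_u_natCast Λ x)
  have hcont : Continuous (ToeplitzQuotient.mkHom Λ) := map_continuous (ToeplitzQuotient.mkHom Λ)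
  intro y
  obtain ⟨a, rfl⟩ := Ideal.Quotient.mk_surjective y
  refine ToeplitzTorus.induction (C := fun a => ∃ b, φ b = ToeplitzQuotient.mkHom Λ a)
    (hrange.preimage hcont) ?_ ?_ ?_ ?_ ?_ ?_ ?_ a
  · exact fun p => ⟨_, hv p⟩
  · exact fun p => ⟨_, (map_star φ _).trans (congrArg star (hv p))⟩
  · exact fun x => ⟨_, hW x⟩
  · exact fun x => ⟨_, (map_star φ _).trans (congrArg star (hW x))⟩
  · exact fun c => ⟨_, AlgHomClass.commutes φ c⟩
  · rintro a b ⟨a', ha⟩ ⟨b', hb⟩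
    exact ⟨a' + b', by rw [map_add, map_add, ha, hb]⟩
  · rintro a b ⟨a', ha⟩ ⟨b', hb⟩
    exact ⟨a' * b', by rw [map_mul, map_mul, ha, hb]⟩

/-- Values of u on ℕᵈ suffice because u_x = u_{x⁺} u_{x⁻}*. -/
theorem BLambda.starAlgHom_ext {Q : Type*} [CStarAlgebra Q] {φ ψ : BLambda.{w} Λ →⋆ₐ[ℂ] Q}
    (hv : ∀ p, φ ((BLambda.pair Λ).v p) = ψ ((BLambda.pair Λ).v p))
    (hu : ∀ x : Fin d → ℕ, φ ((BLambda.pair Λ).u fun j => (x j : ℤ)) =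
      ψ ((BLambda.pair Λ).u fun j => (x j : ℤ))) : φ = ψ := by
  have hc : ∀ χ : BLambda.{w} Λ →⋆ₐ[ℂ] Q, Continuous χ := fun χ => map_continuous χ
  refine StarAlgHom.ext_topologicalClosure (hc φ) (hc ψ) (StarAlgHom.ext_adjoin ?_)
  rintro ⟨_, _⟩ (⟨p, rfl⟩ | ⟨x, rfl⟩)
  · exact hv p
  · change φ ((BLambda.pair Λ).u x) = ψ ((BLambda.pair Λ).u x)
    rw [(BLambda.pair Λ).u_eq_mul_star, map_mul, map_mul, map_star, map_star, hu, hu]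

end isomorphism

theorem mainTheorem8 (k d : ℕ) (Λ : Matrix (Fin k) (Fin d) ℝ) (hΛ : ∀ i j, 0 ≤ Λ i j) :
    ∃! Φ : BLambda.{w} Λ ≃⋆ₐ[ℂ] ToeplitzQuotient Λ,
      (∀ b, ‖Φ b‖ = ‖b‖) ∧
      (∀ p : Fin k → ℕ, Φ ((BLambda.pair Λ).v p) =
        Ideal.Quotient.mk (defectIdeal Λ) (ToeplitzTorus.gen Λ (Fin.append p 0))) ∧
      (∀ x : Fin d → ℕ, Φ ((BLambda.pair Λ).u fun j => (x j : ℤ)) =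
        Ideal.Quotient.mk (defectIdeal Λ) (ToeplitzTorus.gen Λ (Fin.append 0 x))) := by
  let _ := ToeplitzQuotient.cstarAlgebra Λ
  obtain ⟨φ, hv, hu⟩ := BLambda.exists_lift_type.{w} (ToeplitzQuotient.pair Λ)
  have hinj := BLambda.injective_of_map_pair φ hv hu
  have hsurj := BLambda.surjective_of_map_pair φ hv hu
  refine ⟨StarAlgEquiv.ofBijective φ ⟨hinj, hsurj⟩, ⟨?_, ?_, ?_⟩, ?_⟩
  · exact fun b => NonUnitalStarAlgHom.norm_map φ hinj b
  · exact fun p => hv p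
  · exact fun x => (hu _).trans (ToeplitzQuotient.pair_u_natCast Λ x)
  · rintro Ψ ⟨-, hΨv, hΨu⟩
    obtain ⟨ψ, hψ⟩ := Ψ.exists_starAlgHom
    have h : ψ = φ :=
      BLambda.starAlgHom_ext (fun p => ((hψ _).trans (hΨv p)).trans (hv p).symm) fun x =>
        ((hψ _).trans (hΨu x)).trans ((hu _).trans (ToeplitzQuotient.pair_u_natCast Λ x)).symm
    exact StarAlgEquiv.ext fun b => (hψ b).symm.trans (DFunLike.congr_fun h b)
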